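/- All sheaves are sheaves of abelian groups; for a topological space $X$ let $\operatorname{Sh}(X)$ be the abelian category of sheaves on $X$ and $D^+(X)$ its bounded below derived category. A map is *proper* if it is continuous and universally closed. A continuous map $f\colon Y\to X$ is *separated* if the diagonal is closed in $Y\times_X Y$; it is *locally proper* if for every $y\in Y$ and every neighborhood $V$ of $y$ there are neighborhoods $A\subset V$ of $y$ and $U$ of $f(y)$ such that $f(A)\subset U$ and the induced map $f\colon A\to U$ is proper. For continuous $f\colon Y\to X$ write $f^{(*)}$ and $f_{(*)}$ for the inverse and direct image functors of sheaves, and let $f_{(!)}\colon\operatorname{Sh}(Y)\to\operatorname{Sh}(X)$ be the proper direct image, i.e. the left exact subfunctor of $f_{(*)}$ given by $$(f_{(!)}\mathcal F)(U)=\{s\in\mathcal F(f^{-1}(U)) \mid f\colon \operatorname{supp}s\to U \text{ is proper}\}.$$ Write $f^*$ and $f_!$ for the derived functors of $f^{(*)}$ and $f_{(!)}$ on $D^+$, and $\mathrm R$ for right derived functors on $D^+$. Let $$\begin{array}{ccc} W & \xrightarrow{\ q\ } & Y\\ {\scriptstyle g}\downarrow & & \downarrow{\scriptstyle f}\\ Z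 & \xrightarrow{\ p\ } & X\end{array}$$ be a cartesian diagram of topological spaces and continuous maps. The identity $f_{(*)}q_{(*)}=p_{(*)}g_{(*)}$ restricts to a morphism $f_{(!)}q_{(*)}\to p_{(*)}g_{(!)}$, and by adjunction the composition $f_{(!)}\to f_{(!)}q_{(*)}q^{(*)}\to p_{(*)}g_{(!)}q^{(*)}$ yields the base change morphism $\beta\colon p^{(*)}\circ f_{(!)}\to g_{(!)}\circ q^{(*)}$. **Theorem (Derived proper base change).** Assume that $f$ and $g$ are separated and locally proper. Then the canonical morphisms $$\mathrm R(p^{(*)}\circ f_{(!)})\to p^*\circ f_!,\qquad \mathrm R(g_{(!)}\circ q^{(*)})\to g_!\circ q^*$$ are isomorphisms of triangulated functors $D^+(Y)\to D^+(Z)$, and there is an isomorphism of triangulated functors $$p^*\circ f_!\xrightarrow{\ \sim\ } g_!\circ q^*$$ whose composition with $\mathrm R(p^{(*)}\circ f_{(!)})\to p^*\circ f_!$ is equal to the composition $$\mathrm R(p^{(*)}\circ f_{(!)})\xrightarrow{\mathrm R\beta}\mathrm R(g_{(!)}\circ q^{(*)})\to g_!\circ q^*.$$ -/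

import Mathlib

open CategoryTheory Limits TopologicalSpace Opposite Topology Filter

universe u w₁ w₂ w₃ w₄

/-- `f` maps `A` into `U` and the induced map `A → U` of subspaces is proper. -/
def ProperOver {Y X : Type*} [TopologicalSpace Y] [TopologicalSpace X]
    (f : Y → X) (A : Set Y) (U : Set X) : Prop :=
  ∃ h : Set.MapsTo f A U, IsProperMap (h.restrict f A U)

/-- Locally proper maps of topological spaces. -/
def IsLocallyProper {Y X : Type*} [TopologicalSpace Y] [TopologicalSpace X]
    (f : Y → X) : Prop :=
  Continuous f ∧ ∀ y : Y, ∀ V ∈ 𝓝 y, ∃ A ∈ 𝓝 y, ∃ U ∈ 𝓝 (f y), A ⊆ V ∧ ProperOver f A U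

lemma properOver_iff {Y X : Type*} [TopologicalSpace Y] [TopologicalSpace X]
    {f : Y → X} (hf : Continuous f) {A : Set Y} {U : Set X} :
    ProperOver f A U ↔ Set.MapsTo f A U ∧ ∀ 𝒰 : Ultrafilter Y, A ∈ 𝒰 → ∀ x ∈ U,
      Tendsto f 𝒰 (𝓝 x) → ∃ y ∈ A, f y = x ∧ (𝒰 : Filter Y) ≤ 𝓝 y := by
  constructor
  · rintro ⟨h, hp⟩
    refine ⟨h, fun 𝒰 hA x hx ht => ?_⟩
    have hp' := (isProperMap_iff_ultrafilter.1 hp).2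
    let 𝒱 : Ultrafilter A := 𝒰.comap Subtype.val_injective (by simpa using hA)
    have h𝒱 : Filter.map (Subtype.val : A → Y) 𝒱 = 𝒰 := by
      have : (𝒱 : Filter A) = Filter.comap Subtype.val 𝒰 := Ultrafilter.coe_comap _ _ _
      rw [this, Filter.map_comap_of_mem (by simpa using hA)]
    obtain ⟨a, ha, hle⟩ := hp' (𝒰 := 𝒱) (y := ⟨x, hx⟩) (by
      rw [tendsto_subtype_rng]
      have : Tendsto (f ∘ (Subtype.val : A → Y)) 𝒱 (𝓝 x) := by
        rw [← Filter.tendsto_map'_iff, h𝒱]; exact ht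
      exact this)
    refine ⟨a, a.2, congrArg Subtype.val ha, ?_⟩
    rw [← h𝒱]
    exact (Filter.map_mono hle).trans (continuous_subtype_val.tendsto a)
  · rintro ⟨h, hp⟩
    refine ⟨h, isProperMap_iff_ultrafilter.2 ⟨hf.restrict h, fun 𝒱 x ht => ?_⟩⟩
    obtain ⟨y, hy, hyx, hle⟩ := hp (𝒱.map Subtype.val)
      (by
        change Subtype.val ⁻¹' A ∈ 𝒱
        rw [Subtype.coe_preimage_self]
        exact univ_mem) x.1 x.2
      (by
        have := (continuous_subtype_val.tendsto x).comp ht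
        rw [Ultrafilter.coe_map, Filter.tendsto_map'_iff]
        exact this)
    refine ⟨⟨y, hy⟩, Subtype.ext hyx, ?_⟩
    rw [nhds_subtype, ← Filter.map_le_iff_le_comap]
    exact hle

lemma ProperOver.mono {Y X : Type*} [TopologicalSpace Y] [TopologicalSpace X]
    {f : Y → X} (hf : Continuous f) {A B : Set Y} {U V : Set X}
    (h : ProperOver f A U) (hBA : B ⊆ A) (hVU : V ⊆ U) (hBV : Set.MapsTo f B V)
    (hcl : ∀ y ∈ A, f y ∈ V → y ∉ B → Bᶜ ∈ 𝓝 y) : ProperOver f B V := by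
  rw [properOver_iff hf] at h ⊢
  refine ⟨hBV, fun 𝒰 hB x hx ht => ?_⟩
  obtain ⟨y, hy, rfl, hle⟩ := h.2 𝒰 (mem_of_superset hB hBA) x (hVU hx) ht
  refine ⟨y, ?_, rfl, hle⟩
  by_contra hyB
  exact 𝒰.compl_mem_iff_notMem.1 (hle (hcl y hy hx hyB)) hB

lemma ProperOver.union {Y X : Type*} [TopologicalSpace Y] [TopologicalSpace X]
    {f : Y → X} (hf : Continuous f) {A B : Set Y} {U : Set X}
    (hA : ProperOver f A U) (hB : ProperOver f B U) : ProperOver f (A ∪ B) U := by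
  rw [properOver_iff hf] at hA hB ⊢
  refine ⟨hA.1.union hB.1, fun 𝒰 h x hx ht => ?_⟩
  rcases 𝒰.union_mem_iff.1 h with h | h
  · obtain ⟨y, hy, e⟩ := hA.2 𝒰 h x hx ht
    exact ⟨y, Or.inl hy, e⟩
  · obtain ⟨y, hy, e⟩ := hB.2 𝒰 h x hx ht
    exact ⟨y, Or.inr hy, e⟩

/-- Sheaves of abelian groups on a topological space. -/
abbrev Sh (X : TopCat.{u}) := TopCat.Sheaf AddCommGrpCat.{u} X

namespace Sh

variable {X Y Z W : TopCat.{u}}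

/-- The support of a section `s` of a sheaf over an open set `V`: the points of `V` at which the
germ of `s` is non-zero. -/
def supp (F : Sh Y) {V : Opens Y} (s : F.presheaf.obj (op V)) : Set Y :=
  {y | ∃ h : y ∈ V, F.presheaf.germ V y h s ≠ 0}

lemma supp_subset (F : Sh Y) {V : Opens Y} (s : F.presheaf.obj (op V)) : F.supp s ⊆ V :=
  fun _ h => h.1

lemma supp_map (F : Sh Y) {V V' : Opens Y} (i : V' ⟶ V) (s : F.presheaf.obj (op V)) :
    F.supp (F.presheaf.map i.op s) = F.supp s ∩ V' := by
  ext y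
  constructor
  · rintro ⟨h, hs⟩
    rw [TopCat.Presheaf.germ_res_apply] at hs
    exact ⟨⟨_, hs⟩, h⟩
  · rintro ⟨⟨_, hs⟩, h⟩
    refine ⟨h, ?_⟩
    rwa [TopCat.Presheaf.germ_res_apply]

lemma exists_of_notMem_supp (F : Sh Y) {V : Opens Y} (s : F.presheaf.obj (op V)) {y : Y}
    (hy : y ∈ V) (h : y ∉ F.supp s) :
    ∃ (V' : Opens Y) (_ : y ∈ V') (i : V' ⟶ V), F.presheaf.map i.op s = 0 := by
  have : F.presheaf.germ V y hy s = F.presheaf.germ V y hy 0 := by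
    by_contra h'
    exact h ⟨hy, by simpa using h'⟩
  obtain ⟨V', hV', i, j, e⟩ := F.presheaf.germ_eq y hy hy _ _ this
  exact ⟨V', hV', i, by simpa using e⟩

lemma supp_zero (F : Sh Y) {V : Opens Y} : F.supp (0 : F.presheaf.obj (op V)) = ∅ := by
  ext y
  simp [supp]

lemma compl_supp_mem_nhds (F : Sh Y) {V : Opens Y} (s : F.presheaf.obj (op V)) {y : Y}
    (hy : y ∈ V) (h : y ∉ F.supp s) : (F.supp s)ᶜ ∈ 𝓝 y := by
  obtain ⟨V', hV', i, e⟩ := F.exists_of_notMem_supp s hy h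
  refine mem_of_superset (V'.isOpen.mem_nhds hV') fun z hz hzs => ?_
  have := (F.supp_map i s).symm.subset ⟨hzs, hz⟩
  rw [e, supp_zero] at this
  exact this

lemma supp_add_subset (F : Sh Y) {V : Opens Y} (s t : F.presheaf.obj (op V)) :
    F.supp (s + t) ⊆ F.supp s ∪ F.supp t := by
  rintro y ⟨h, hy⟩
  by_contra hn
  simp only [supp, Set.mem_union, Set.mem_ofPred_eq, not_or, not_exists, not_not] at hn
  exact hy (by rw [map_add, hn.1 h, hn.2 h, add_zero])

lemma supp_neg (F : Sh Y) {V : Opens Y} (s : F.presheaf.obj (op V)) :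
    F.supp (-s) = F.supp s := by
  simp [supp]

lemma supp_hom_subset {F G : Sh Y} (φ : F ⟶ G) {V : Opens Y} (s : F.presheaf.obj (op V)) :
    G.supp (φ.hom.app (op V) s) ⊆ F.supp s := by
  rintro y ⟨h, hy⟩
  refine ⟨h, fun h0 => hy ?_⟩
  rw [← TopCat.Presheaf.stalkFunctor_map_germ_apply]
  exact (congrArg _ h0).trans (map_zero _)

/-- The sections `s` of `F` over `f⁻¹(U)` such that `f : supp s → U` is proper. -/
def properSections (f : Y ⟶ X) (F : Sh Y) (U : Opens X) :
    AddSubgroup (F.presheaf.obj (op ((Opens.map f).obj U))) where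
  carrier := {s | ProperOver f (F.supp s) (U : Set X)}
  zero_mem' := by
    change ProperOver f (F.supp 0) (U : Set X)
    rw [supp_zero, properOver_iff f.hom.continuous]
    exact ⟨Set.mapsTo_empty _ _, fun 𝒰 h => (𝒰.empty_notMem h).elim⟩
  add_mem' {s t} hs ht := by
    refine (hs.union f.hom.continuous ht).mono f.hom.continuous (F.supp_add_subset s t) subset_rfl
      (F.supp_subset _) fun _ _ hy hy' => F.compl_supp_mem_nhds _ hy hy'
  neg_mem' {s} hs := by
    change ProperOver f (F.supp (-s)) (U : Set X)
    rw [supp_neg]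
    exact hs

lemma map_mem_properSections (f : Y ⟶ X) (F : Sh Y) {U V : Opens X} (i : V ⟶ U)
    {s : F.presheaf.obj (op ((Opens.map f).obj U))} (hs : s ∈ properSections f F U) :
    F.presheaf.map ((Opens.map f).map i).op s ∈ properSections f F V := by
  refine ProperOver.mono f.hom.continuous hs ?_ i.le (F.supp_subset _)
    fun _ _ hy hy' => F.compl_supp_mem_nhds _ hy hy'
  rw [supp_map]
  exact Set.inter_subset_left

lemma hom_mem_properSections (f : Y ⟶ X) {F G : Sh Y} (φ : F ⟶ G) {U : Opens X}
    {s : F.presheaf.obj (op ((Opens.map f).obj U))} (hs : s ∈ properSections f F U) :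
    φ.hom.app _ s ∈ properSections f G U :=
  ProperOver.mono f.hom.continuous hs (supp_hom_subset φ s) subset_rfl (G.supp_subset _)
    fun _ _ hy hy' => G.compl_supp_mem_nhds _ hy hy'

/-- The presheaf underlying the proper direct image of `F`. -/
def properDirectImagePresheaf (f : Y ⟶ X) (F : Sh Y) : TopCat.Presheaf AddCommGrpCat.{u} X where
  obj U := AddCommGrpCat.of (properSections f F U.unop)
  map {U V} i := AddCommGrpCat.ofHom
    (((F.presheaf.map ((Opens.map f).map i.unop).op).hom.comp
      (properSections f F U.unop).subtype).codRestrict (properSections f F V.unop)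
        fun s => map_mem_properSections f F i.unop s.2)
  map_id U := by
    ext s
    exact ConcreteCategory.congr_hom (F.presheaf.map_id _) s.1
  map_comp {U V T} i j := by
    ext s
    exact ConcreteCategory.congr_hom (F.presheaf.map_comp
      ((Opens.map f).map i.unop).op ((Opens.map f).map j.unop).op) s.1

lemma properDirectImagePresheaf_isSheaf (f : Y ⟶ X) (F : Sh Y) :
    (properDirectImagePresheaf f F).IsSheaf := by
  rw [TopCat.Presheaf.isSheaf_iff_isSheafUniqueGluing]
  intro ι U sf hsf
  obtain ⟨s, hs, huniq⟩ := (TopCat.Presheaf.isSheaf_iff_isSheafUniqueGluing _).1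
    ((TopCat.Sheaf.pushforward AddCommGrpCat.{u} f).obj F).2 U (fun i => (sf i).1)
    (fun i j => congrArg Subtype.val (hsf i j))
  have hsupp : ∀ i, F.supp (V := (Opens.map f).obj (iSup U)) s ∩ (Opens.map f).obj (U i) =
      F.supp (V := (Opens.map f).obj (U i)) (sf i).1 := fun i => by
    refine (F.supp_map ((Opens.map f).map (Opens.leSupr U i)) s).symm.trans ?_
    exact congrArg (F.supp (V := (Opens.map f).obj (U i))) (hs i)
  have hmem : s ∈ properSections f F (iSup U) := by
    refine (properOver_iff f.hom.continuous).2 ⟨F.supp_subset _, fun 𝒰 hA x hx ht => ?_⟩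
    obtain ⟨i, hi⟩ := Opens.mem_iSup.1 hx
    have h1 : f ⁻¹' (U i) ∈ 𝒰 := ht ((U i).isOpen.mem_nhds hi)
    obtain ⟨y, hy, e⟩ := ((properOver_iff f.hom.continuous).1 (sf i).2).2 𝒰
      (mem_of_superset (inter_mem hA h1) (hsupp i).subset) x hi ht
    exact ⟨y, ((hsupp i).symm.subset hy).1, e⟩
  refine ⟨⟨s, hmem⟩, fun i => Subtype.ext (hs i), fun t ht => Subtype.ext ?_⟩
  exact huniq t.1 fun i => congrArg Subtype.val (ht i)

/-- The proper direct image functor `f_(!)`. -/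
noncomputable def properDirectImage (f : Y ⟶ X) : Sh Y ⥤ Sh X where
  obj F := ⟨properDirectImagePresheaf f F, properDirectImagePresheaf_isSheaf f F⟩
  map {F G} φ := ⟨{
    app U := AddCommGrpCat.ofHom (((φ.hom.app _).hom.comp
      (properSections f F U.unop).subtype).codRestrict (properSections f G U.unop)
        fun s => hom_mem_properSections f φ s.2)
    naturality U V i := by
      ext s
      apply Subtype.ext
      exact ConcreteCategory.congr_hom (φ.hom.naturality ((Opens.map f).map i.unop).op) s.1 }⟩
  map_id F := rfl
  map_comp φ ψ := rfl

instance (f : Y ⟶ X) : (properDirectImage f).Additive where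
  map_add := rfl

/-- The inverse image functor `f^(*)`. -/
noncomputable abbrev inverseImage (f : Y ⟶ X) : Sh X ⥤ Sh Y :=
  TopCat.Sheaf.pullback AddCommGrpCat.{u} f

/-- The direct image functor `f_(*)`. -/
noncomputable abbrev directImage (f : Y ⟶ X) : Sh Y ⥤ Sh X :=
  TopCat.Sheaf.pushforward AddCommGrpCat.{u} f

instance (f : Y ⟶ X) : (directImage f).Additive where
  map_add := rfl

instance (f : Y ⟶ X) : (inverseImage f).Additive :=
  (TopCat.Sheaf.pullbackPushforwardAdjunction AddCommGrpCat.{u} f).left_adjoint_additive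

lemma nhds_eq_of_homeomorph {S A B : Type*} [TopologicalSpace S] [TopologicalSpace A]
    [TopologicalSpace B] {P : A × B → Prop} (e : S ≃ₜ {a : A × B // P a}) (x : S) :
    𝓝 x = comap (fun x => (e x).1.1) (𝓝 (e x).1.1) ⊓ comap (fun x => (e x).1.2) (𝓝 (e x).1.2) := by
  refine ((IsInducing.subtypeVal.comp e.isInducing).nhds_eq_comap x).trans ?_
  rw [nhds_prod_eq, Filter.prod_eq_inf, Filter.comap_inf, Filter.comap_comap, Filter.comap_comap]
  rfl

lemma properOver_baseChange {f : Y ⟶ X} {q : W ⟶ Y} {p : Z ⟶ X} {g : W ⟶ Z}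
    (sq : IsPullback q g f p) {A : Set Y} {B : Set W} {U : Set X}
    (hA : ProperOver f A U) (hBA : Set.MapsTo q B A)
    (hcl : ∀ x : W, p (g x) ∈ U → x ∉ B → Bᶜ ∈ 𝓝 x) :
    ProperOver g B (p ⁻¹' U) := by
  have hw : ∀ x : W, f (q x) = p (g x) := fun x => ConcreteCategory.congr_hom sq.w x
  rw [properOver_iff f.hom.continuous] at hA
  refine (properOver_iff g.hom.continuous).2 ⟨fun x hx => ?_, fun 𝒰 hB z hz ht => ?_⟩
  · change p (g x) ∈ U
    rw [← hw]
    exact hA.1 (hBA hx)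
  · obtain ⟨y, hy, hyz, hle⟩ := hA.2 (𝒰.map q) (mem_of_superset (x := B) hB hBA) (p z) hz (by
      rw [Ultrafilter.coe_map, tendsto_map'_iff]
      have : (f ∘ q : W → X) = p ∘ g := funext hw
      rw [this]
      exact (p.hom.continuous.tendsto z).comp ht)
    obtain ⟨x, hx1, hx2, hind⟩ : ∃ x : W, q x = y ∧ g x = z ∧
        𝓝 x = comap q (𝓝 (q x)) ⊓ comap g (𝓝 (g x)) := by
      let e : W ≅ (TopCat.pullbackCone f p).pt :=
        sq.isLimit.conePointUniqueUpToIso (TopCat.pullbackConeIsLimit f p)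
      have h1 : e.hom ≫ TopCat.pullbackFst f p = q :=
        sq.isLimit.conePointUniqueUpToIso_hom_comp (TopCat.pullbackConeIsLimit f p) .left
      have h2 : e.hom ≫ TopCat.pullbackSnd f p = g :=
        sq.isLimit.conePointUniqueUpToIso_hom_comp (TopCat.pullbackConeIsLimit f p) .right
      let t : {a : Y × Z // f a.1 = p a.2} := ⟨(y, z), hyz⟩
      have ht : e.hom (e.inv t) = t := ConcreteCategory.congr_hom e.inv_hom_id t
      refine ⟨e.inv t, ?_, ?_, ?_⟩
      · rw [← h1]
        exact congrArg (fun a => a.1.1) ht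
      · rw [← h2]
        exact congrArg (fun a => a.1.2) ht
      · refine (nhds_eq_of_homeomorph (TopCat.homeoOfIso e :
          W ≃ₜ {a : Y × Z // f a.1 = p a.2}) (e.inv t)).trans ?_
        rw [← h1, ← h2]
        rfl
    have hle' : (𝒰 : Filter W) ≤ 𝓝 x := by
      rw [hind, hx1, hx2]
      exact le_inf (map_le_iff_le_comap.1 hle) (map_le_iff_le_comap.1 ht)
    refine ⟨x, ?_, hx2, hle'⟩
    by_contra hxB
    exact 𝒰.compl_mem_iff_notMem.1 (hle' (hcl x (by rw [hx2]; exact hz) hxB)) hB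

/-- For a cartesian square `f ∘ q = p ∘ g`, the equality of open sets `q⁻¹(f⁻¹(U)) = g⁻¹(p⁻¹(U))`,
as a morphism. -/
def opensHom {f : Y ⟶ X} {q : W ⟶ Y} {p : Z ⟶ X} {g : W ⟶ Z} (w : q ≫ f = g ≫ p) (U : Opens X) :
    (Opens.map g).obj ((Opens.map p).obj U) ⟶ (Opens.map q).obj ((Opens.map f).obj U) :=
  homOfLE fun x hx => by
    change (q ≫ f) x ∈ U
    rw [w]
    exact hx

lemma baseChange_mem {f : Y ⟶ X} {q : W ⟶ Y} {p : Z ⟶ X} {g : W ⟶ Z}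
    (sq : IsPullback q g f p) (G : Sh W) (U : Opens X)
    {s : G.presheaf.obj (op ((Opens.map q).obj ((Opens.map f).obj U)))}
    (hs : s ∈ properSections f ((directImage q).obj G) U) :
    G.presheaf.map (opensHom sq.w U).op s ∈ properSections g G ((Opens.map p).obj U) := by
  refine properOver_baseChange sq hs ?_ fun x hx hx' => G.compl_supp_mem_nhds _ hx hx'
  rw [supp_map]
  rintro x ⟨hx, -⟩
  by_contra hn
  obtain ⟨V, hV, i, e⟩ := exists_of_notMem_supp ((directImage q).obj G)
    (V := (Opens.map f).obj U) s hx.1 hn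
  have h1 := (G.supp_map ((Opens.map q).map i) s).symm.subset ⟨hx, hV⟩
  have h2 : G.presheaf.map ((Opens.map q).map i).op s = 0 := e
  rw [h2, supp_zero] at h1
  exact h1

/-- For a cartesian square, the morphism `f_(!) ∘ q_(*) ⟶ p_(*) ∘ g_(!)` which is the restriction of
the identity `f_(*) ∘ q_(*) = p_(*) ∘ g_(*)`. -/
noncomputable def directBaseChange {f : Y ⟶ X} {q : W ⟶ Y} {p : Z ⟶ X} {g : W ⟶ Z}
    (sq : IsPullback q g f p) :
    directImage q ⋙ properDirectImage f ⟶ properDirectImage g ⋙ directImage p where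
  app G := ⟨{
    app U := AddCommGrpCat.ofHom (((G.presheaf.map (opensHom sq.w U.unop).op).hom.comp
      (properSections f ((directImage q).obj G) U.unop).subtype).codRestrict
        (properSections g G ((Opens.map p).obj U.unop)) fun s => baseChange_mem sq G U.unop s.2)
    naturality U V i := by
      ext s
      apply Subtype.ext
      exact (ConcreteCategory.congr_hom (G.presheaf.map_comp
        ((Opens.map q).map ((Opens.map f).map i.unop)).op (opensHom sq.w V.unop).op) s.1).symm.trans
        (ConcreteCategory.congr_hom (G.presheaf.map_comp (opensHom sq.w U.unop).op
        ((Opens.map g).map ((Opens.map p).map i.unop)).op) s.1) }⟩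
  naturality G G' φ := by
    apply ObjectProperty.hom_ext
    ext U s
    exact Subtype.ext
      (ConcreteCategory.congr_hom (φ.hom.naturality (opensHom sq.w U.unop).op).symm s.1)

/-- For a cartesian square, the proper base change morphism `p^(*) ∘ f_(!) ⟶ g_(!) ∘ q^(*)`:
it is adjoint to the composition `f_(!) ⟶ f_(!) ∘ q_(*) ∘ q^(*) ⟶ p_(*) ∘ g_(!) ∘ q^(*)`. -/
noncomputable def baseChange {f : Y ⟶ X} {q : W ⟶ Y} {p : Z ⟶ X} {g : W ⟶ Z}
    (sq : IsPullback q g f p) :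
    properDirectImage f ⋙ inverseImage p ⟶ inverseImage q ⋙ properDirectImage g where
  app F :=
    ((TopCat.Sheaf.pullbackPushforwardAdjunction AddCommGrpCat.{u} p).homEquiv _ _).symm
      ((properDirectImage f).map
          ((TopCat.Sheaf.pullbackPushforwardAdjunction AddCommGrpCat.{u} q).unit.app F) ≫
        (directBaseChange sq).app ((inverseImage q).obj F))
  naturality F F' φ := by
    have h1 := (TopCat.Sheaf.pullbackPushforwardAdjunction AddCommGrpCat.{u} q).unit.naturality φ
    have h2 := (directBaseChange sq).naturality ((inverseImage q).map φ)
    dsimp only [Functor.comp_obj, Functor.comp_map, Functor.id_obj, Functor.id_map] at h1 h2 ⊢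
    rw [← Adjunction.homEquiv_naturality_left_symm, ← Adjunction.homEquiv_naturality_right_symm,
      ← Functor.map_comp_assoc, h1, Functor.map_comp_assoc, h2, Category.assoc]

end Sh

noncomputable section

namespace CategoryTheory.Functor

variable {C D E : Type*} [Category* C] [Category* D] [Category* E]
  [Abelian C] [Abelian D] [Abelian E]

lemma natTrans_commShift_of_whiskerLeft {A B H : Type*} [Category* A] [Category* B] [Category* H]
    [HasShift A ℤ] [HasShift B ℤ] [HasShift H ℤ] (i : A ⥤ B) {G₁ G₂ : B ⥤ H} [i.CommShift ℤ]
    [G₁.CommShift ℤ] [G₂.CommShift ℤ] (τ : G₁ ⟶ G₂) [NatTrans.CommShift (whiskerLeft i τ) ℤ]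
    (h : ∀ K : B, ∃ (I : A) (w : K ⟶ i.obj I), IsIso (G₂.map w)) : NatTrans.CommShift τ ℤ where
  shift_comm a := by
    apply NatTrans.ext
    funext K
    obtain ⟨I, w, hw⟩ := h K
    have key := NatTrans.shift_app_comm (whiskerLeft i τ) a I
    simp only [commShiftIso_comp_hom_app, whiskerLeft_app, Category.assoc, comp_obj] at key
    rw [← NatTrans.naturality_assoc] at key
    have H := (cancel_epi _).1 key
    have h3 := (G₁.commShiftIso a).hom.naturality w
    have h4 := (G₂.commShiftIso a).hom.naturality w
    simp only [comp_map, comp_obj] at h3 h4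
    simp only [NatTrans.comp_app, whiskerRight_app, whiskerLeft_app]
    rw [← cancel_mono ((shiftFunctor _ a).map (G₂.map w)), Category.assoc, ← Functor.map_comp,
      ← τ.naturality, Functor.map_comp, ← reassoc_of% h3, H, Category.assoc, ← h4,
      NatTrans.naturality_assoc]

section
variable (C) [HasDerivedCategory C]

/-- The functor `K⁺(Inj C) ⥤ D⁺(C)`. -/
abbrev injectivesToDerivedPlus : HomotopyCategory.Plus (InjectiveObject C) ⥤ DerivedCategory.Plus C :=
  (InjectiveObject.ι C).mapHomotopyCategoryPlus ⋙ DerivedCategory.Plus.Qh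

lemma injectivesToDerivedPlus_map_bijective (K L : HomotopyCategory.Plus (InjectiveObject C)) :
    Function.Bijective ((injectivesToDerivedPlus C).map : (K ⟶ L) → _) := by
  have h : CochainComplex.IsKInjective
      (((InjectiveObject.ι C).mapHomotopyCategoryPlus.obj L).1.as) := by
    have (M : CochainComplex.Plus (InjectiveObject C)) : CochainComplex.IsKInjective
      (((InjectiveObject.ι C).mapHomologicalComplex (.up ℤ)).obj M.obj) := inferInstance
    exact this ⟨L.obj.as, (HomotopyCategory.plus_quotient_obj_iff _).1 L.property⟩
  exact (DerivedCategory.Plus.Qh_map_bijective_of_isKInjective _ _ h).comp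
    ((FullyFaithful.ofFullyFaithful (InjectiveObject.ι C).mapHomotopyCategoryPlus).map_bijective
      K L)

instance : (injectivesToDerivedPlus C).Full where
  map_surjective := (injectivesToDerivedPlus_map_bijective C _ _).2

instance : (injectivesToDerivedPlus C).Faithful where
  map_injective {K L} := fun {_ _} h => (injectivesToDerivedPlus_map_bijective C K L).1 h

instance [EnoughInjectives C] : (injectivesToDerivedPlus C).IsEquivalence where

instance [EnoughInjectives C] : (injectivesToDerivedPlus C).IsLocalization
    (MorphismProperty.isomorphisms _) :=
  IsLocalization.of_isEquivalence _ _ (fun _ _ _ h => h)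
end

variable [HasDerivedCategory C] [HasDerivedCategory D] [HasDerivedCategory E]

section
variable [EnoughInjectives C] (F : C ⥤ D) [F.Additive]

instance : IsIso (whiskerLeft (InjectiveObject.ι C).mapHomotopyCategoryPlus
    F.rightDerivedFunctorPlusUnit) := by
  rw [NatTrans.isIso_iff_isIso_app]
  intro K
  exact inferInstanceAs (IsIso (F.rightDerivedFunctorPlusUnit.app
    ((InjectiveObject.ι C).mapHomotopyCategoryPlus.obj K)))

/-- On complexes of injective objects, the right derived functor is computed by `F`. -/
def rightDerivedFunctorPlusInjectivesIso :
    injectivesToDerivedPlus C ⋙ F.rightDerivedFunctorPlus ≅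
      (InjectiveObject.ι C).mapHomotopyCategoryPlus ⋙ F.mapHomotopyCategoryPlus ⋙
        DerivedCategory.Plus.Qh :=
  (asIso (whiskerLeft (InjectiveObject.ι C).mapHomotopyCategoryPlus
    F.rightDerivedFunctorPlusUnit)).symm

instance rightDerivedFunctorPlusLifting :
    Localization.Lifting (injectivesToDerivedPlus C) (MorphismProperty.isomorphisms _)
      ((InjectiveObject.ι C).mapHomotopyCategoryPlus ⋙ F.mapHomotopyCategoryPlus ⋙
        DerivedCategory.Plus.Qh) F.rightDerivedFunctorPlus :=
  ⟨rightDerivedFunctorPlusInjectivesIso F⟩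

/-- The compatibility of the right derived functor with the shift: it is the one for which
the unit `F ⟶ RF` commutes with the shift. -/
instance rightDerivedFunctorPlusCommShift : F.rightDerivedFunctorPlus.CommShift ℤ :=
  commShiftOfLocalization (injectivesToDerivedPlus C) (MorphismProperty.isomorphisms _) ℤ
    ((InjectiveObject.ι C).mapHomotopyCategoryPlus ⋙ F.mapHomotopyCategoryPlus ⋙
        DerivedCategory.Plus.Qh) F.rightDerivedFunctorPlus

instance : NatTrans.CommShift (rightDerivedFunctorPlusInjectivesIso F).hom ℤ :=
  NatTrans.commShift_iso_hom_of_localization (injectivesToDerivedPlus C)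
    (MorphismProperty.isomorphisms _) ℤ
    ((InjectiveObject.ι C).mapHomotopyCategoryPlus ⋙ F.mapHomotopyCategoryPlus ⋙
        DerivedCategory.Plus.Qh) F.rightDerivedFunctorPlus

instance : F.rightDerivedFunctorPlus.IsTriangulated :=
  isTriangulated_of_precomp_iso (rightDerivedFunctorPlusInjectivesIso F)

/-- The unit of the right derived functor commutes with the shift. -/
instance rightDerivedFunctorPlusUnit_commShift :
    NatTrans.CommShift F.rightDerivedFunctorPlusUnit ℤ := by
  have e : ((rightDerivedFunctorPlusInjectivesIso F).inv ≫ (associator _ _ _).hom) =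
    whiskerLeft (InjectiveObject.ι C).mapHomotopyCategoryPlus F.rightDerivedFunctorPlusUnit := by
    ext K
    simp [rightDerivedFunctorPlusInjectivesIso]
  have key : NatTrans.CommShift (whiskerLeft (InjectiveObject.ι C).mapHomotopyCategoryPlus
      F.rightDerivedFunctorPlusUnit) ℤ := by
    rw [← e]
    infer_instance
  refine natTrans_commShift_of_whiskerLeft (InjectiveObject.ι C).mapHomotopyCategoryPlus _
    fun K => ?_
  let r : (HomotopyCategory.Plus.localizerMorphism C).RightResolution K := Classical.arbitrary _
  have hw : IsIso (DerivedCategory.Plus.Qh.map r.w) :=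
    Localization.inverts DerivedCategory.Plus.Qh (HomotopyCategory.Plus.quasiIso C) _ r.hw
  exact ⟨r.X₁, r.w, inferInstanceAs (IsIso (F.rightDerivedFunctorPlus.map
    (DerivedCategory.Plus.Qh.map r.w)))⟩

end

/-- The natural transformation on bounded below homotopy categories induced by a natural
transformation of additive functors. -/
def natTransMapHomotopyCategoryPlus {F G : C ⥤ D} [F.Additive] [G.Additive] (τ : F ⟶ G) :
    F.mapHomotopyCategoryPlus ⟶ G.mapHomotopyCategoryPlus where
  app K := ObjectProperty.homMk
    ((NatTrans.mapHomotopyCategory τ (.up ℤ)).app K.obj)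
  naturality K L f := by
    ext
    exact (NatTrans.mapHomotopyCategory τ (.up ℤ)).naturality f.hom

/-- The morphism `RF ⟶ RG` of right derived functors induced by `τ : F ⟶ G`. -/
def rightDerivedPlusNatTrans [EnoughInjectives C] {F G : C ⥤ D} [F.Additive] [G.Additive]
    (τ : F ⟶ G) : F.rightDerivedFunctorPlus ⟶ G.rightDerivedFunctorPlus :=
  rightDerivedNatTrans _ _ F.rightDerivedFunctorPlusUnit G.rightDerivedFunctorPlusUnit
    (HomotopyCategory.Plus.quasiIso C)
    (whiskerRight (natTransMapHomotopyCategoryPlus τ) DerivedCategory.Plus.Qh)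

/-- The canonical morphism `R(G ∘ F) ⟶ RG ∘ RF`, obtained from the universal property of
`R(G ∘ F)` and the morphism `G ∘ F ⟶ RG ∘ F ⟶ RG ∘ RF` given by the units of `RG` and `RF`. -/
def rightDerivedPlusComp [EnoughInjectives C] [EnoughInjectives D] (F : C ⥤ D) (G : D ⥤ E)
    [F.Additive] [G.Additive] :
    (F ⋙ G).rightDerivedFunctorPlus ⟶ F.rightDerivedFunctorPlus ⋙ G.rightDerivedFunctorPlus :=
  rightDerivedDesc _ (F ⋙ G).rightDerivedFunctorPlusUnit (HomotopyCategory.Plus.quasiIso C) _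
    (whiskerRight (mapHomotopyCategoryPlusCompIso (Iso.refl (F ⋙ G))).inv DerivedCategory.Plus.Qh ≫
      whiskerLeft F.mapHomotopyCategoryPlus G.rightDerivedFunctorPlusUnit ≫
      whiskerRight F.rightDerivedFunctorPlusUnit G.rightDerivedFunctorPlus)

end CategoryTheory.Functor

/-- An isomorphism of triangulated functors: both functors are triangulated, and the natural
transformation is an isomorphism which commutes with the shift. -/
structure IsTriangulatedIso {C D : Type*} [Category* C] [Category* D]
    [HasZeroObject C] [HasShift C ℤ] [Preadditive C] [∀ n : ℤ, (shiftFunctor C n).Additive]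
    [Pretriangulated C]
    [HasZeroObject D] [HasShift D ℤ] [Preadditive D] [∀ n : ℤ, (shiftFunctor D n).Additive]
    [Pretriangulated D]
    {F G : C ⥤ D} [F.CommShift ℤ] [G.CommShift ℤ] (τ : F ⟶ G) : Prop where
  source_isTriangulated : F.IsTriangulated
  target_isTriangulated : G.IsTriangulated
  commShift : NatTrans.CommShift τ ℤ
  isIso : IsIso τ

namespace Sh

variable {X Y : TopCat.{u}} [HasDerivedCategory.{w₁} (Sh X)] [HasDerivedCategory.{w₂} (Sh Y)]

/-- The derived proper direct image `f_! : D⁺(Y) ⥤ D⁺(X)`. -/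
abbrev derivedProperDirectImage (f : Y ⟶ X) :
    DerivedCategory.Plus (Sh Y) ⥤ DerivedCategory.Plus (Sh X) :=
  (properDirectImage f).rightDerivedFunctorPlus

/-- The derived functor `f^* : D⁺(X) ⥤ D⁺(Y)` of the (exact) inverse image functor `f^(*)`. -/
abbrev derivedInverseImage (f : Y ⟶ X) :
    DerivedCategory.Plus (Sh X) ⥤ DerivedCategory.Plus (Sh Y) :=
  (inverseImage f).rightDerivedFunctorPlus

end Sh

end

/-
The stalk of `f_! F` at `x` is the group of compactly supported sections of `F` on the fiber over
`x`: properness lets a section with compact support extend from the fiber to the preimage of a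
neighborhood of `x`. As the fiber of `g` over `z` is homeomorphic to the fiber of `f` over `p z`,
the base change morphism is an isomorphism on stalks, before any derivation.

To derive it, use the sheaves which are soft on the fibers of `g`. They contain the inverse images
under `q` of the injective sheaves on `Y`, they are closed under cokernels of monomorphisms, and
`g_!` is exact on short exact sequences of such sheaves; so they compute `R g_!`. As inverse image
functors are exact, both comparison morphisms are isomorphisms, and so is `R β`.
-/

section

variable {Y X : Type*} [TopologicalSpace Y] {f : Y → X}

lemma t2Space_fiber_of_isSeparatedMap (hf : IsSeparatedMap f) (x : X) : T2Space (f ⁻¹' {x}) := by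
  rw [t2space_iff_isSeparatedMap x]
  have h : f ∘ (Subtype.val : f ⁻¹' {x} → Y) = fun _ => x := funext Subtype.prop
  exact h ▸ hf.comp_right continuous_subtype_val Subtype.val_injective

variable [TopologicalSpace X]

lemma ProperOver.empty (hc : Continuous f) (U : Set X) : ProperOver f ∅ U :=
  (properOver_iff hc).2 ⟨Set.mapsTo_empty _ _, fun 𝒰 h => (𝒰.empty_notMem h).elim⟩

lemma ProperOver.inter_preimage (hc : Continuous f) {A : Set Y} {U V : Set X}
    (h : ProperOver f A U) (hVU : V ⊆ U) : ProperOver f (A ∩ f ⁻¹' V) V :=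
  h.mono hc Set.inter_subset_left hVU (fun _ hy => hy.2)
    fun _ hy hyV hyn => (hyn ⟨hy, hyV⟩).elim

lemma ProperOver.union_inter_preimage (hc : Continuous f) {A A' : Set Y} {U U' : Set X}
    (h : ProperOver f A U) (h' : ProperOver f A' U') :
    ProperOver f ((A ∪ A') ∩ f ⁻¹' (U ∩ U')) (U ∩ U') := by
  rw [Set.union_inter_distrib_right]
  exact (h.inter_preimage hc Set.inter_subset_left).union hc
    (h'.inter_preimage hc Set.inter_subset_right)

lemma ProperOver.isCompact_inter_fiber (hc : Continuous f) {A : Set Y} {U : Set X}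
    (h : ProperOver f A U) {x : X} (hx : x ∈ U) : IsCompact (A ∩ f ⁻¹' {x}) := by
  rw [isCompact_iff_ultrafilter_le_nhds']
  intro 𝒰 h𝒰
  have hA : A ∈ 𝒰 := mem_of_superset h𝒰 Set.inter_subset_left
  have hfx : f ⁻¹' {x} ∈ 𝒰 := mem_of_superset h𝒰 Set.inter_subset_right
  obtain ⟨y, hy, hyx, hle⟩ := ((properOver_iff hc).1 h).2 𝒰 hA x hx
    ((le_pure_iff.2 (show {x} ∈ Filter.map f 𝒰 from hfx)).trans (pure_le_nhds x))
  exact ⟨y, ⟨hy, hyx⟩, hle⟩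

lemma ProperOver.exists_isOpen_inter_preimage_subset (hc : Continuous f) {A : Set Y} {U : Set X}
    (h : ProperOver f A U) {x : X} (hx : x ∈ U) {G : Set Y} (hG : IsOpen G)
    (hAG : A ∩ f ⁻¹' {x} ⊆ G) : ∃ V : Set X, IsOpen V ∧ x ∈ V ∧ A ∩ f ⁻¹' V ⊆ G := by
  by_contra! hn
  have hne : (𝓟 (A \ G) ⊓ comap f (𝓝 x)).NeBot := by
    rw [inf_comm, ((nhds_basis_opens x).comap f).inf_principal_neBot_iff]
    rintro V ⟨hxV, hV⟩
    obtain ⟨y, ⟨hyA, hyV⟩, hyG⟩ := Set.not_subset.1 (hn V hV hxV)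
    exact ⟨y, hyV, hyA, hyG⟩
  set 𝒰 := Ultrafilter.of (𝓟 (A \ G) ⊓ comap f (𝓝 x))
  have hle : (𝒰 : Filter Y) ≤ 𝓟 (A \ G) ⊓ comap f (𝓝 x) := Ultrafilter.of_le _
  have hAG𝒰 : A \ G ∈ 𝒰 := hle.trans inf_le_left (mem_principal_self _)
  obtain ⟨y, hy, hyx, h𝒰y⟩ := ((properOver_iff hc).1 h).2 𝒰 (mem_of_superset hAG𝒰 Set.sdiff_subset)
    x hx (tendsto_iff_comap.2 (hle.trans inf_le_right))
  have hG𝒰 : G ∈ 𝒰 := h𝒰y (hG.mem_nhds (hAG ⟨hy, hyx⟩))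
  exact 𝒰.compl_mem_iff_notMem.1 (mem_of_superset hAG𝒰 fun _ hz => hz.2) hG𝒰

lemma ProperOver.compl_mem_nhds (hc : Continuous f) (hf : IsSeparatedMap f) {A : Set Y}
    {U : Set X} (h : ProperOver f A U) {y : Y} (hyU : f y ∈ U) (hy : y ∉ A) : Aᶜ ∈ 𝓝 y := by
  by_contra hn
  have hne : (𝓝 y ⊓ 𝓟 A).NeBot := by
    rwa [← mem_interior_iff_mem_nhds, interior_compl, Set.notMem_compl_iff,
      mem_closure_iff_nhdsWithin_neBot] at hn
  set 𝒰 := Ultrafilter.of (𝓝 y ⊓ 𝓟 A)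
  have hle : (𝒰 : Filter Y) ≤ 𝓝 y ⊓ 𝓟 A := Ultrafilter.of_le _
  obtain ⟨y', hy', hyy', h𝒰y'⟩ := ((properOver_iff hc).1 h).2 𝒰
    (hle.trans inf_le_right (mem_principal_self A)) (f y) hyU
    ((hc.tendsto y).mono_left (hle.trans inf_le_left))
  have hd : Disjoint (𝓝 y) (𝓝 y') :=
    isSeparatedMap_iff_disjoint_nhds.1 hf _ _ hyy'.symm (ne_of_mem_of_not_mem hy' hy).symm
  exact 𝒰.neBot.ne (le_bot_iff.1 (hd (hle.trans inf_le_left) h𝒰y'))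

lemma IsLocallyProper.locallyCompactSpace_fiber (hf : IsLocallyProper f) (x : X) :
    LocallyCompactSpace (f ⁻¹' {x}) where
  local_compact_nhds a N hN := by
    rw [nhds_subtype, mem_comap] at hN
    obtain ⟨V, hV, hVN⟩ := hN
    obtain ⟨A, hA, U, hU, hAV, hp⟩ := hf.2 a V hV
    have hax : f a = x := a.2
    refine ⟨Subtype.val ⁻¹' A, continuous_subtype_val.continuousAt.preimage_mem_nhds hA,
      (Set.preimage_mono hAV).trans hVN, ?_⟩
    rw [Subtype.isCompact_iff, Subtype.image_preimage_coe, Set.inter_comm]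
    exact hp.isCompact_inter_fiber hf.1 (hax ▸ mem_of_mem_nhds hU)

lemma IsLocallyProper.exists_properOver_of_isCompact (hf : IsLocallyProper f) {x : X} {K : Set Y}
    (hK : IsCompact K) (hKx : K ⊆ f ⁻¹' {x}) :
    ∃ (A : Set Y) (U : Set X), K ⊆ interior A ∧ IsOpen U ∧ x ∈ U ∧ ProperOver f A U := by
  let IsCovered (S : Set Y) : Prop := ∃ (A : Set Y) (U : Set X),
    S ∩ K ⊆ interior A ∧ IsOpen U ∧ x ∈ U ∧ ProperOver f A U
  suffices IsCovered K by simpa only [IsCovered, Set.inter_self] using this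
  refine hK.induction_on ?_ ?_ ?_ ?_
  · exact ⟨∅, Set.univ, by simp, isOpen_univ, Set.mem_univ _, .empty hf.1 _⟩
  · rintro S S' hS ⟨A, U, h, h'⟩
    exact ⟨A, U, (Set.inter_subset_inter_left _ hS).trans h, h'⟩
  · rintro S S' ⟨A, U, hS, hU, hx, hA⟩ ⟨A', U', hS', hU', hx', hA'⟩
    refine ⟨_, _, ?_, hU.inter hU', ⟨hx, hx'⟩, hA.union_inter_preimage hf.1 hA'⟩
    rw [interior_inter, ((hU.inter hU').preimage hf.1).interior_eq, Set.union_inter_distrib_right]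
    refine Set.subset_inter ?_ fun y hy => ?_
    · exact Set.union_subset (hS.trans (interior_mono Set.subset_union_left))
        (hS'.trans (interior_mono Set.subset_union_right))
    · obtain rfl : f y = x := hKx (hy.elim And.right And.right)
      exact ⟨hx, hx'⟩
  · intro y hy
    obtain rfl : f y = x := hKx hy
    obtain ⟨A, hA, U, hU, -, hp⟩ := hf.2 y Set.univ univ_mem
    have hU' : f ⁻¹' interior U ∈ 𝓝 y := hf.1.continuousAt (interior_mem_nhds.2 hU)
    refine ⟨interior (A ∩ f ⁻¹' interior U),
      mem_nhdsWithin_of_mem_nhds (interior_mem_nhds.2 (inter_mem hA hU')), _, _,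
      Set.inter_subset_left, isOpen_interior, mem_interior_iff_mem_nhds.2 hU,
      hp.inter_preimage hf.1 interior_subset⟩

end

namespace Sh

/-- The map induced on stalks by a morphism of sheaves. -/
noncomputable abbrev stalkMap {Y : TopCat.{u}} {F G : Sh Y} (a : F ⟶ G) (y : Y) :
    F.presheaf.stalk y ⟶ G.presheaf.stalk y :=
  (TopCat.Presheaf.stalkFunctor AddCommGrpCat.{u} y).map a.hom

lemma stalkMap_germ {Y : TopCat.{u}} {F G : Sh Y} (a : F ⟶ G) {U : Opens Y} {y : Y} (hy : y ∈ U)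
    (σ : F.presheaf.obj (op U)) :
    stalkMap a y (F.presheaf.germ U y hy σ) = G.presheaf.germ U y hy (a.hom.app (op U) σ) :=
  TopCat.Presheaf.stalkFunctor_map_germ_apply U y hy a.hom σ

section ContinuousSectionOn

variable {Y : TopCat.{u}} {T : Type*} [TopologicalSpace T]

/-- A family of germs `s t ∈ F_{φ t}` is a continuous section of `F` along `φ` on `K` if it is
continuous on `K` as a map to the étale space of `F`. On a subspace, these are the sections of the
restriction of `F`, without passing to a pullback sheaf. -/
def ContinuousSectionOn (F : Sh Y) (φ : T → Y) (s : ∀ t, F.presheaf.stalk (φ t)) (K : Set T) :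
    Prop :=
  ContinuousOn (fun t => (⟨φ t, s t⟩ : F.presheaf.EtaleSpace)) K

variable {F G : Sh Y} {φ : T → Y} {s s' : ∀ t, F.presheaf.stalk (φ t)} {K L : Set T}

namespace ContinuousSectionOn

lemma continuousOn (h : F.ContinuousSectionOn φ s K) : ContinuousOn φ K :=
  (TopCat.Presheaf.EtaleSpace.continuous_base F.presheaf).comp_continuousOn h

lemma eventually_eq_germ (h : F.ContinuousSectionOn φ s K) {t : T} (ht : t ∈ K) :
    ∃ (V : Opens Y) (σ : F.presheaf.obj (op V)),
      ∀ᶠ t' in 𝓝[K] t, ∃ h : φ t' ∈ V, s t' = F.presheaf.germ V (φ t') h σ := by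
  obtain ⟨V, hV, σ, hσ⟩ := F.presheaf.exists_germ_eq (s t)
  exact ⟨V, σ, (h t ht).eventually (TopCat.Presheaf.EtaleSpace.eventually_nhds
    (⟨φ t, s t⟩ : F.presheaf.EtaleSpace) hV σ hσ)⟩

lemma of_eventually_eq_germ (hφ : ContinuousOn φ K)
    (h : ∀ t ∈ K, ∃ (V : Opens Y) (σ : F.presheaf.obj (op V)),
      ∀ᶠ t' in 𝓝[K] t, ∃ h : φ t' ∈ V, s t' = F.presheaf.germ V (φ t') h σ) :
    F.ContinuousSectionOn φ s K := fun t ht => by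
  obtain ⟨V, σ, hσ⟩ := h t ht
  obtain ⟨hV, hσt⟩ := hσ.self_of_nhdsWithin ht
  refine tendsto_nhds_generateFrom_iff.2 ?_
  rintro _ ⟨U, ρ, rfl⟩ ⟨hU, hρ⟩
  obtain ⟨O, hO, i, j, hij⟩ := F.presheaf.germ_eq _ hV hU σ ρ (hσt.symm.trans hρ)
  filter_upwards [hσ, hφ t ht (O.isOpen.mem_nhds hO)] with t' ⟨ht'V, ht'⟩ hO'
  refine ⟨j.le hO', ht'.trans ?_⟩
  rw [← F.presheaf.germ_res_apply i _ hO', hij, F.presheaf.germ_res_apply]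

lemma of_germ {V : Opens Y} (σ : F.presheaf.obj (op V)) (hφ : ContinuousOn φ K)
    (hs : ∀ t ∈ K, ∃ h : φ t ∈ V, s t = F.presheaf.germ V (φ t) h σ) :
    F.ContinuousSectionOn φ s K :=
  of_eventually_eq_germ hφ fun _ _ => ⟨V, σ, eventually_mem_nhdsWithin.mono hs⟩

lemma zero (F : Sh Y) (hφ : ContinuousOn φ K) : F.ContinuousSectionOn φ (fun _ => 0) K :=
  of_germ (V := ⊤) 0 hφ fun _ _ => ⟨trivial, (map_zero _).symm⟩

lemma mono (h : F.ContinuousSectionOn φ s K) (hLK : L ⊆ K) : F.ContinuousSectionOn φ s L :=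
  ContinuousOn.mono h hLK

lemma congr (h : F.ContinuousSectionOn φ s K) (e : ∀ t ∈ K, s' t = s t) :
    F.ContinuousSectionOn φ s' K :=
  ContinuousOn.congr h fun t ht => by rw [e t ht]

lemma union_of_isClosed (hK : F.ContinuousSectionOn φ s K) (hL : F.ContinuousSectionOn φ s L)
    (hK' : IsClosed K) (hL' : IsClosed L) : F.ContinuousSectionOn φ s (K ∪ L) :=
  ContinuousOn.union_of_isClosed hK hL hK' hL'

lemma union_of_isOpen (hK : F.ContinuousSectionOn φ s K) (hL : F.ContinuousSectionOn φ s L)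
    (hK' : IsOpen K) (hL' : IsOpen L) : F.ContinuousSectionOn φ s (K ∪ L) :=
  ContinuousOn.union_of_isOpen hK hL hK' hL'

lemma add (h : F.ContinuousSectionOn φ s K) (h' : F.ContinuousSectionOn φ s' K) :
    F.ContinuousSectionOn φ (fun t => s t + s' t) K :=
  of_eventually_eq_germ h.continuousOn fun t ht => by
    obtain ⟨V, σ, hσ⟩ := h.eventually_eq_germ ht
    obtain ⟨V', σ', hσ'⟩ := h'.eventually_eq_germ ht
    refine ⟨V ⊓ V', F.presheaf.map (homOfLE inf_le_left).op σ +
      F.presheaf.map (homOfLE inf_le_right).op σ', ?_⟩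
    filter_upwards [hσ, hσ'] with t' ⟨hV, e⟩ ⟨hV', e'⟩
    refine ⟨Opens.mem_inf.2 ⟨hV, hV'⟩, ?_⟩
    rw [map_add, F.presheaf.germ_res_apply, F.presheaf.germ_res_apply, e, e']

lemma map (a : F ⟶ G) (h : F.ContinuousSectionOn φ s K) :
    G.ContinuousSectionOn φ (fun t => stalkMap a (φ t) (s t)) K :=
  of_eventually_eq_germ h.continuousOn fun t ht => by
    obtain ⟨V, σ, hσ⟩ := h.eventually_eq_germ ht
    refine ⟨V, a.hom.app (op V) σ, hσ.mono fun t' ⟨hV, e⟩ => ⟨hV, ?_⟩⟩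
    rw [e]
    exact stalkMap_germ a hV σ

lemma neg (h : F.ContinuousSectionOn φ s K) : F.ContinuousSectionOn φ (fun t => - s t) K :=
  of_eventually_eq_germ h.continuousOn fun t ht => by
    obtain ⟨V, σ, hσ⟩ := h.eventually_eq_germ ht
    exact ⟨V, -σ, hσ.mono fun t' ⟨hV, e⟩ => ⟨hV, by rw [e, map_neg]⟩⟩

lemma sub (h : F.ContinuousSectionOn φ s K) (h' : F.ContinuousSectionOn φ s' K) :
    F.ContinuousSectionOn φ (fun t => s t - s' t) K :=
  (h.add h'.neg).congr fun _ _ => sub_eq_add_neg _ _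

lemma eventually_eq (h : F.ContinuousSectionOn φ s K) (h' : F.ContinuousSectionOn φ s' K) {t : T}
    (ht : t ∈ K) (e : s t = s' t) : ∀ᶠ t' in 𝓝[K] t, s t' = s' t' := by
  obtain ⟨V, σ, hσ⟩ := h.eventually_eq_germ ht
  obtain ⟨V', σ', hσ'⟩ := h'.eventually_eq_germ ht
  obtain ⟨hV, hσt⟩ := hσ.self_of_nhdsWithin ht
  obtain ⟨hV', hσt'⟩ := hσ'.self_of_nhdsWithin ht
  obtain ⟨O, hO, i, j, hij⟩ := F.presheaf.germ_eq _ hV hV' σ σ' (by rw [← hσt, ← hσt', e])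
  filter_upwards [hσ, hσ', h.continuousOn t ht (O.isOpen.mem_nhds hO)] with t' ⟨_, e₁⟩ ⟨_, e₂⟩ hO'
  rw [e₁, e₂, ← F.presheaf.germ_res_apply i _ hO', hij, F.presheaf.germ_res_apply]

lemma isOpen_setOf_eq (h : F.ContinuousSectionOn φ s K) (h' : F.ContinuousSectionOn φ s' K)
    (hK : IsOpen K) : IsOpen {t | t ∈ K ∧ s t = s' t} := by
  refine isOpen_iff_mem_nhds.2 fun t ht => ?_
  have ev := h.eventually_eq h' ht.1 ht.2
  rw [hK.nhdsWithin_eq ht.1] at ev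
  filter_upwards [ev, hK.mem_nhds ht.1] with t' e ht' using ⟨ht', e⟩

lemma isOpen_setOf_eq_zero (h : F.ContinuousSectionOn φ s K) (hK : IsOpen K) :
    IsOpen {t | t ∈ K ∧ s t = 0} :=
  h.isOpen_setOf_eq (zero F h.continuousOn) hK

open Classical in
lemma ite_zero (h : F.ContinuousSectionOn φ s K) (hφ : Continuous φ) (hK : IsOpen K)
    (hL : IsOpen L) : F.ContinuousSectionOn φ (fun t => if t ∈ L then s t else 0)
      (K ∩ L ∪ {t | t ∈ K ∧ s t = 0} ∪ interior Lᶜ) := by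
  have onL := (h.mono (L := K ∩ L) Set.inter_subset_left).congr
    (s' := fun t => if t ∈ L then s t else 0) fun t ht => if_pos ht.2
  have onZeros := (zero F (K := {t | t ∈ K ∧ s t = 0}) hφ.continuousOn).congr
    (s' := fun t => if t ∈ L then s t else 0) fun t ht => by rw [ht.2, ite_self]
  have offL := (zero F (K := interior Lᶜ) hφ.continuousOn).congr
    (s' := fun t => if t ∈ L then s t else 0) fun t ht => if_neg (interior_subset ht)
  have hZ := h.isOpen_setOf_eq_zero hK
  exact (onL.union_of_isOpen onZeros (hK.inter hL) hZ).union_of_isOpen offL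
    ((hK.inter hL).union hZ) isOpen_interior

lemma exists_glue (h : F.ContinuousSectionOn φ s K) (h' : F.ContinuousSectionOn φ s' L)
    (hK : IsOpen K) (hL : IsOpen L) (e : ∀ t ∈ K ∩ L, s t = s' t) :
    ∃ r : ∀ t, F.presheaf.stalk (φ t), F.ContinuousSectionOn φ r (K ∪ L) ∧
      (∀ t ∈ K, r t = s t) ∧ ∀ t ∈ L, r t = s' t := by
  classical
  let r (t : T) : F.presheaf.stalk (φ t) := if t ∈ K then s t else s' t
  have hrK : ∀ t ∈ K, r t = s t := fun t ht => if_pos ht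
  have hrL : ∀ t ∈ L, r t = s' t := fun t ht => by
    by_cases htK : t ∈ K
    · exact (hrK t htK).trans (e t ⟨htK, ht⟩)
    · exact if_neg htK
  exact ⟨r, (h.congr hrK).union_of_isOpen (h'.congr hrL) hK hL, hrK, hrL⟩

lemma exists_germ_eq {r : ∀ y, F.presheaf.stalk y} {O : Opens Y}
    (h : F.ContinuousSectionOn id r O) :
    ∃ σ : F.presheaf.obj (op O), ∀ (y : Y) (hy : y ∈ O), F.presheaf.germ O y hy σ = r y := by
  have key : ∀ y : O, ∃ (V : Opens Y) (_ : y.1 ∈ V) (_ : V ≤ O) (σ : F.presheaf.obj (op V)),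
      ∀ (z : Y) (hz : z ∈ V), F.presheaf.germ V z hz σ = r z := fun y => by
    obtain ⟨V, σ, ev⟩ := h.eventually_eq_germ y.2
    rw [O.isOpen.nhdsWithin_eq y.2] at ev
    obtain ⟨N, hN, hNo, hyN⟩ := eventually_nhds_iff.1 ev
    have hle : (⟨N, hNo⟩ ⊓ O : Opens Y) ≤ V := fun z hz => (hN z hz.1).1
    refine ⟨⟨N, hNo⟩ ⊓ O, ⟨hyN, y.2⟩, inf_le_right, F.presheaf.map (homOfLE hle).op σ,
      fun z hz => ?_⟩
    rw [F.presheaf.germ_res_apply]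
    exact (hN z hz.1).2.symm
  choose V hyV hVO σ hσ using key
  have compatible : TopCat.Presheaf.IsCompatible F.presheaf V σ := fun y y' => by
    apply TopCat.Presheaf.section_ext
    intro z hz
    exact ((F.presheaf.germ_res_apply _ z hz _).trans (hσ y z hz.1)).trans
      ((F.presheaf.germ_res_apply _ z hz _).trans (hσ y' z hz.2)).symm
  obtain ⟨ρ, hρ, -⟩ := TopCat.Sheaf.existsUnique_gluing' F V O (fun y => homOfLE (hVO y))
    (fun y hy => Opens.mem_iSup.2 ⟨⟨y, hy⟩, hyV _⟩) σ compatible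
  refine ⟨ρ, fun y hy => ?_⟩
  rw [← hσ ⟨y, hy⟩ y (hyV _), ← hρ ⟨y, hy⟩]
  exact (F.presheaf.germ_res_apply _ _ _ _).symm

end ContinuousSectionOn

lemma exists_continuousSectionOn_germ (F : Sh Y) {V : Opens Y} (σ : F.presheaf.obj (op V)) :
    ∃ r : ∀ y, F.presheaf.stalk y, F.ContinuousSectionOn id r V ∧
      ∀ (y : Y) (hy : y ∈ V), r y = F.presheaf.germ V y hy σ := by
  classical
  let r : ∀ y, F.presheaf.stalk y := fun y => if h : y ∈ V then F.presheaf.germ V y h σ else 0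
  have hr (y : Y) (hy : y ∈ V) : r y = F.presheaf.germ V y hy σ := dif_pos hy
  exact ⟨r, .of_germ σ continuousOn_id fun y hy => ⟨hy, hr y hy⟩, hr⟩

lemma exists_continuousSectionOn_apply_eq (F : Sh Y) (hφ : ContinuousOn φ K) {t : T} (ht : t ∈ K)
    (a : F.presheaf.stalk (φ t)) :
    ∃ L ∈ 𝓝[K] t, L ⊆ K ∧ ∃ r, F.ContinuousSectionOn φ r L ∧ r t = a := by
  obtain ⟨V, hV, σ, rfl⟩ := F.presheaf.exists_germ_eq a
  obtain ⟨r, -, hr⟩ := F.exists_continuousSectionOn_germ σ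
  exact ⟨K ∩ φ ⁻¹' V, inter_mem self_mem_nhdsWithin
    ((hφ t ht).preimage_mem_nhdsWithin (V.isOpen.mem_nhds hV)), Set.inter_subset_left,
    fun t => r (φ t), .of_germ σ (hφ.mono Set.inter_subset_left) fun t' ht' =>
      ⟨ht'.2, hr _ ht'.2⟩, hr _ hV⟩

lemma ContinuousSectionOn.of_injective_comp {Z : TopCat.{u}} {H : Sh Z} {ψ : T → Z}
    (hφ : ContinuousOn φ K) (θ : ∀ t, F.presheaf.stalk (φ t) → H.presheaf.stalk (ψ t))
    (θ_injective : ∀ t, Function.Injective (θ t))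
    (hθ : ∀ r L, F.ContinuousSectionOn φ r L → L ⊆ K →
      H.ContinuousSectionOn ψ (fun t => θ t (r t)) L)
    (h : H.ContinuousSectionOn ψ (fun t => θ t (s t)) K) : F.ContinuousSectionOn φ s K :=
  of_eventually_eq_germ hφ fun t ht => by
    obtain ⟨L, hL, hLK, r, hr, hrt⟩ := F.exists_continuousSectionOn_apply_eq hφ ht (s t)
    have htL : t ∈ L := mem_of_mem_nhdsWithin ht hL
    obtain ⟨V, σ, hσ⟩ := hr.eventually_eq_germ htL
    have hsr := (h.mono hLK).eventually_eq (hθ r L hr hLK) htL (congrArg (θ t) hrt.symm)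
    refine ⟨V, σ, Eventually.filter_mono (nhdsWithin_le_of_mem hL) ?_⟩
    filter_upwards [hσ, hsr] with t' ⟨hV, e⟩ hsr'
    exact ⟨hV, (θ_injective t' hsr').trans e⟩

/-- The family of germs `s` is the restriction to `C`, along `φ`, of a continuous section on an
open neighbourhood of `φ '' C`. -/
def ExtendsToNhd (F : Sh Y) (φ : T → Y) (s : ∀ t, F.presheaf.stalk (φ t)) (C : Set T) : Prop :=
  ∃ (O : Opens Y) (r : ∀ y, F.presheaf.stalk y), F.ContinuousSectionOn id r O ∧
    ∀ t ∈ C, φ t ∈ O ∧ r (φ t) = s t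

lemma ExtendsToNhd.union (hφ : Continuous φ)
    (hd : Pairwise fun t t' => Disjoint (𝓝 (φ t)) (𝓝 (φ t'))) {C₁ C₂ : Set T}
    (hC₁ : IsCompact C₁) (hC₂ : IsCompact C₂)
    (h₁ : F.ExtendsToNhd φ s C₁) (h₂ : F.ExtendsToNhd φ s C₂) :
    F.ExtendsToNhd φ s (C₁ ∪ C₂) := by
  obtain ⟨O₁, r₁, h₁, e₁⟩ := h₁
  obtain ⟨O₂, r₂, h₂, e₂⟩ := h₂
  let E : Set Y := {y | y ∈ (O₁ : Set Y) ∩ O₂ ∧ r₁ y = r₂ y}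
  have hE : IsOpen E := (h₁.mono Set.inter_subset_left).isOpen_setOf_eq
    (h₂.mono Set.inter_subset_right) (O₁.isOpen.inter O₂.isOpen)
  -- Away from the open set `E` of agreement, the two compact subsets have separated images.
  have hD : Disjoint (𝓝ˢ (φ '' (C₁ \ φ ⁻¹' E))) (𝓝ˢ (φ '' (C₂ \ φ ⁻¹' E))) := by
    rw [((hC₁.diff (hE.preimage hφ)).image hφ).disjoint_nhdsSet_left]
    rintro _ ⟨t, ht, rfl⟩
    rw [((hC₂.diff (hE.preimage hφ)).image hφ).disjoint_nhdsSet_right]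
    rintro _ ⟨t', ht', rfl⟩
    refine hd ?_
    rintro rfl
    exact ht.2 ⟨⟨(e₁ t ht.1).1, (e₂ t ht'.1).1⟩, (e₁ t ht.1).2.trans (e₂ t ht'.1).2.symm⟩
  obtain ⟨A₁, A₂, hA₁, hA₂, hs₁, hs₂, hA⟩ := separatedNhds_iff_disjoint.2 hD
  have hB₁ : IsOpen (A₁ ∩ O₁ ∪ E) := (hA₁.inter O₁.isOpen).union hE
  have hB₂ : IsOpen (A₂ ∩ O₂ ∪ E) := (hA₂.inter O₂.isOpen).union hE
  have agree : ∀ y ∈ (A₁ ∩ O₁ ∪ E) ∩ (A₂ ∩ O₂ ∪ E), r₁ y = r₂ y := by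
    rintro y ⟨hy | hy, hy' | hy'⟩
    exacts [(Set.disjoint_left.1 hA hy.1 hy'.1).elim, hy'.2, hy.2, hy.2]
  obtain ⟨r, hr, hr₁, hr₂⟩ := ContinuousSectionOn.exists_glue
    (h₁.mono (Set.union_subset Set.inter_subset_right fun y hy => hy.1.1))
    (h₂.mono (Set.union_subset Set.inter_subset_right fun y hy => hy.1.2)) hB₁ hB₂ agree
  have hφ₁ : ∀ t ∈ C₁, φ t ∈ A₁ ∩ O₁ ∪ E := fun t ht => or_iff_not_imp_right.2 fun htE =>
    ⟨hs₁ ⟨t, ⟨ht, htE⟩, rfl⟩, (e₁ t ht).1⟩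
  have hφ₂ : ∀ t ∈ C₂, φ t ∈ A₂ ∩ O₂ ∪ E := fun t ht => or_iff_not_imp_right.2 fun htE =>
    ⟨hs₂ ⟨t, ⟨ht, htE⟩, rfl⟩, (e₂ t ht).1⟩
  refine ⟨⟨_, hB₁.union hB₂⟩, r, hr, ?_⟩
  rintro t (ht | ht)
  · exact ⟨Or.inl (hφ₁ t ht), (hr₁ _ (hφ₁ t ht)).trans (e₁ t ht).2⟩
  · exact ⟨Or.inr (hφ₂ t ht), (hr₂ _ (hφ₂ t ht)).trans (e₂ t ht).2⟩

lemma ContinuousSectionOn.extendsToNhd [LocallyCompactSpace T] (hφ : Continuous φ)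
    (hd : Pairwise fun t t' => Disjoint (𝓝 (φ t)) (𝓝 (φ t'))) (hK : IsCompact K)
    (h : F.ContinuousSectionOn φ s K) : F.ExtendsToNhd φ s K := by
  have : T2Space T := t2Space_iff_disjoint_nhds.2 fun t t' htt' =>
    (hφ.tendsto t).disjoint (hd htt') (hφ.tendsto t')
  let ExtendsNear (S : Set T) : Prop :=
    ∃ C : Set T, IsCompact C ∧ S ∩ K ⊆ C ∧ F.ExtendsToNhd φ s C
  suffices ExtendsNear K by
    obtain ⟨C, -, hKC, O, r, hr, e⟩ := this
    exact ⟨O, r, hr, fun t ht => e t (hKC ⟨ht, ht⟩)⟩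
  refine hK.induction_on ?_ ?_ ?_ ?_
  · exact ⟨∅, isCompact_empty, by simp, ⊥, fun _ => 0, .zero F continuousOn_id, by simp⟩
  · rintro S S' hS ⟨C, hC, hSC, hext⟩
    exact ⟨C, hC, (Set.inter_subset_inter_left _ hS).trans hSC, hext⟩
  · rintro S S' ⟨C, hC, hSC, hext⟩ ⟨C', hC', hSC', hext'⟩
    refine ⟨C ∪ C', hC.union hC', ?_, hext.union hφ hd hC hC' hext'⟩
    rw [Set.union_inter_distrib_right]
    exact Set.union_subset_union hSC hSC'
  · intro t ht
    obtain ⟨V, σ, ev⟩ := h.eventually_eq_germ ht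
    obtain ⟨N, hN, hNK⟩ := mem_nhdsWithin_iff_exists_mem_nhds_inter.1 ev
    obtain ⟨C, hC, hCN, hCc⟩ := LocallyCompactSpace.local_compact_nhds t N hN
    obtain ⟨r, hr, hrσ⟩ := F.exists_continuousSectionOn_germ σ
    refine ⟨C, mem_nhdsWithin_of_mem_nhds hC, C ∩ K, hCc.inter_right hK.isClosed, subset_rfl,
      V, r, hr, fun t' ht' => ?_⟩
    obtain ⟨hV', e⟩ := hNK ⟨hCN ht'.1, ht'.2⟩
    exact ⟨hV', (hrσ _ hV').trans e.symm⟩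

/-- The family of germs `s` is a continuous section of `F` along `φ` with compact support. -/
structure CompactlySupported (F : Sh Y) (φ : T → Y) (s : ∀ t, F.presheaf.stalk (φ t)) : Prop where
  continuousSectionOn : F.ContinuousSectionOn φ s Set.univ
  exists_isCompact : ∃ K : Set T, IsCompact K ∧ ∀ t ∉ K, s t = 0

end ContinuousSectionOn

section Fiber

variable {X Y : TopCat.{u}} {f : Y ⟶ X} {F : Sh Y} {x : X}
  {T : Type*} [TopologicalSpace T] {φ : T → Y} {s : ∀ t, F.presheaf.stalk (φ t)}

lemma exists_map_eq_zero_of_germ_fiber_eq_zero {U : Opens X} (hx : x ∈ U)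
    {σ : F.presheaf.obj (op ((Opens.map f).obj U))} (hσ : σ ∈ properSections f F U)
    (h : ∀ (y : Y) (hy : f y ∈ U), f y = x →
      F.presheaf.germ ((Opens.map f).obj U) y hy σ = 0) :
    ∃ (V : Opens X) (i : V ⟶ U), x ∈ V ∧ F.presheaf.map ((Opens.map f).map i).op σ = 0 := by
  obtain ⟨V, hV, hxV, hVσ⟩ := ProperOver.exists_isOpen_inter_preimage_subset f.hom.continuous hσ hx
    isOpen_empty fun y hy => hy.1.2 (h y hy.1.1 hy.2)
  refine ⟨⟨V, hV⟩ ⊓ U, homOfLE inf_le_right, ⟨hxV, hx⟩, ?_⟩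
  apply TopCat.Presheaf.section_ext
  intro y hy
  by_contra hn
  have hsupp : y ∈ F.supp (F.presheaf.map ((Opens.map f).map
      (homOfLE inf_le_right : ⟨V, hV⟩ ⊓ U ⟶ U)).op σ) := ⟨hy, by simpa using hn⟩
  rw [supp_map] at hsupp
  exact hVσ ⟨hsupp.1, hy.1⟩

open Classical in
lemma exists_properSections_germ_eq_ite (hf : IsSeparatedMap f) {A : Set Y} {U₀ : Set X}
    (hA : ProperOver f A U₀) (hU₀ : IsOpen U₀) (hx : x ∈ U₀) {O : Opens Y}
    {r : ∀ y, F.presheaf.stalk y} (hr : F.ContinuousSectionOn id r O)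
    (hAx : A ∩ f ⁻¹' {x} ⊆ O ∩ interior A ∪ {y | y ∈ O ∧ r y = 0}) :
    ∃ U : Opens X, x ∈ U ∧ ∃ σ ∈ properSections f F U, ∀ (y : Y) (hy : y ∈ (Opens.map f).obj U),
      F.presheaf.germ _ y hy σ = if y ∈ interior A then r y else 0 := by
  have hc : Continuous f := f.hom.continuous
  obtain ⟨U₁, hU₁, hxU₁, hAU₁⟩ := hA.exists_isOpen_inter_preimage_subset hc hx
    ((O.isOpen.inter isOpen_interior).union (hr.isOpen_setOf_eq_zero O.isOpen)) hAx
  let U : Opens X := ⟨U₀ ∩ U₁, hU₀.inter hU₁⟩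
  obtain ⟨σ, hσ⟩ := ((hr.ite_zero continuous_id O.isOpen
    (isOpen_interior (s := A))).mono (L := ((Opens.map f).obj U : Opens Y)) fun y hy => by
      by_cases hyA : y ∈ A
      · exact Or.inl (hAU₁ ⟨hyA, hy.2⟩)
      · exact Or.inr (interior_mono (Set.compl_subset_compl.2 interior_subset)
          (mem_interior_iff_mem_nhds.2 (hA.compl_mem_nhds hc hf hy.1 hyA)))).exists_germ_eq
  refine ⟨U, ⟨hx, hxU₁⟩, σ, ?_, hσ⟩
  refine hA.mono hc ?_ Set.inter_subset_left (F.supp_subset _)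
    fun _ _ hy hy' => F.compl_supp_mem_nhds _ hy hy'
  rintro y ⟨hy, hne⟩
  rw [hσ y hy, ite_ne_right_iff] at hne
  exact interior_subset hne.1

lemma exists_properSections_of_compactlySupported (hf : IsSeparatedMap f) (hf' : IsLocallyProper f)
    (hφ : IsEmbedding φ) (hφx : Set.range φ = f ⁻¹' {x}) (hs : F.CompactlySupported φ s) :
    ∃ (U : Opens X) (_ : x ∈ U), ∃ σ ∈ properSections f F U,
      ∀ (t : T) (ht : φ t ∈ (Opens.map f).obj U), F.presheaf.germ _ (φ t) ht σ = s t := by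
  classical
  have hmem : ∀ t, f (φ t) = x := fun t => hφx.subset ⟨t, rfl⟩
  obtain ⟨K, hK, hsK⟩ := hs.exists_isCompact
  obtain ⟨A, U₀, hKA, hU₀, hxU₀, hA⟩ := hf'.exists_properOver_of_isCompact
    (hK.image hφ.continuous) (x := x) (by rintro _ ⟨t, -, rfl⟩; exact hmem t)
  have hs_zero : ∀ t, φ t ∉ interior A → s t = 0 := fun t ht =>
    hsK t fun htK => ht (hKA ⟨t, htK, rfl⟩)
  have : LocallyCompactSpace T := by
    have := hf'.locallyCompactSpace_fiber x
    exact (hφ.toHomeomorph.trans (.setCongr hφx)).isClosedEmbedding.locallyCompactSpace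
  have hAT : IsCompact (φ ⁻¹' A) := by
    rw [hφ.isCompact_iff, Set.image_preimage_eq_inter_range, hφx]
    exact hA.isCompact_inter_fiber hf'.1 hxU₀
  obtain ⟨O, r, hr, hrs⟩ := (hs.continuousSectionOn.mono (Set.subset_univ _)).extendsToNhd
    hφ.continuous (fun t t' htt' => isSeparatedMap_iff_disjoint_nhds.1 hf _ _
      ((hmem t).trans (hmem t').symm) (hφ.injective.ne htt')) hAT
  obtain ⟨U, hxU, σ, hσ, hσr⟩ := exists_properSections_germ_eq_ite hf hA hU₀ hxU₀ hr
    fun y ⟨hyA, hyx⟩ => by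
      obtain ⟨t, rfl⟩ := hφx.symm.subset hyx
      by_cases ht : φ t ∈ interior A
      · exact Or.inl ⟨(hrs t hyA).1, ht⟩
      · exact Or.inr ⟨(hrs t hyA).1, (hrs t hyA).2.trans (hs_zero t ht)⟩
  refine ⟨U, hxU, σ, hσ, fun t ht => (hσr _ ht).trans ?_⟩
  split_ifs with htA
  · exact (hrs t (Set.mem_preimage.2 (interior_subset htA))).2
  · exact (hs_zero t htA).symm

lemma compactlySupported_of_mem_properSections (hφ : IsEmbedding φ)
    (hφx : Set.range φ = f ⁻¹' {x}) {U : Opens X} (hx : x ∈ U)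
    {σ : F.presheaf.obj (op ((Opens.map f).obj U))} (hσ : σ ∈ properSections f F U)
    (hs : ∀ (t : T) (ht : φ t ∈ (Opens.map f).obj U), s t = F.presheaf.germ _ (φ t) ht σ) :
    F.CompactlySupported φ s where
  continuousSectionOn := .of_germ σ hφ.continuous.continuousOn fun t _ =>
    have ht : f (φ t) ∈ U := (hφx.subset ⟨t, rfl⟩ : f (φ t) = x) ▸ hx
    ⟨ht, hs t ht⟩
  exists_isCompact := by
    refine ⟨φ ⁻¹' F.supp σ, ?_, fun t ht => ?_⟩
    · rw [hφ.isCompact_iff, Set.image_preimage_eq_inter_range, hφx]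
      exact ProperOver.isCompact_inter_fiber f.hom.continuous hσ hx
    · have htU : f (φ t) ∈ U := (hφx.subset ⟨t, rfl⟩ : f (φ t) = x) ▸ hx
      by_contra hn
      exact ht ⟨htU, fun h => hn ((hs t htU).trans h)⟩

end Fiber

section StalkPull

variable {X Y Z W : TopCat.{u}}

/-- The pullback of sections of `F` to sections of the inverse image of `F`. -/
noncomputable def pullSection (q : W ⟶ Y) (F : Sh Y) (U : Opens Y) :
    F.presheaf.obj (op U) ⟶
      ((inverseImage q).obj F).presheaf.obj (op ((Opens.map q).obj U)) :=
  ((TopCat.Sheaf.pullbackPushforwardAdjunction AddCommGrpCat.{u} q).unit.app F).hom.app (op U)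

/-- The canonical map from the stalk of `F` at `q w` to the stalk of its inverse image at `w`. -/
noncomputable def stalkPull (q : W ⟶ Y) (F : Sh Y) (w : W) :
    F.presheaf.stalk (q w) ⟶ ((inverseImage q).obj F).presheaf.stalk w :=
  (TopCat.Presheaf.stalkFunctor _ (q w)).map
    ((TopCat.Sheaf.pullbackPushforwardAdjunction AddCommGrpCat.{u} q).unit.app F).hom ≫
    TopCat.Presheaf.stalkPushforward _ q ((inverseImage q).obj F).presheaf w

lemma germ_comp_stalkPull (q : W ⟶ Y) (F : Sh Y) (w : W) (U : Opens Y) (hU : q w ∈ U) :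
    F.presheaf.germ U (q w) hU ≫ stalkPull q F w =
      pullSection q F U ≫ ((inverseImage q).obj F).presheaf.germ ((Opens.map q).obj U) w hU :=
  (TopCat.Presheaf.stalkFunctor_map_germ_assoc U (q w) hU
    ((TopCat.Sheaf.pullbackPushforwardAdjunction AddCommGrpCat.{u} q).unit.app F).hom
    (TopCat.Presheaf.stalkPushforward _ q ((inverseImage q).obj F).presheaf w)).trans
      (congrArg (pullSection q F U ≫ ·)
        (TopCat.Presheaf.stalkPushforward_germ _ q ((inverseImage q).obj F).presheaf U w hU))

lemma germ_pullSection (q : W ⟶ Y) (F : Sh Y) (w : W) {U : Opens Y} (hU : q w ∈ U)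
    (σ : F.presheaf.obj (op U)) :
    ((inverseImage q).obj F).presheaf.germ ((Opens.map q).obj U) w hU (pullSection q F U σ) =
      stalkPull q F w (F.presheaf.germ U (q w) hU σ) :=
  (ConcreteCategory.congr_hom (germ_comp_stalkPull q F w U hU) σ).symm

lemma pullSection_comp_app_homEquiv_symm (q : W ⟶ Y) {F : Sh Y} {G : Sh W}
    (a : F ⟶ (directImage q).obj G) (U : Opens Y) :
    pullSection q F U ≫ (((TopCat.Sheaf.pullbackPushforwardAdjunction AddCommGrpCat.{u} q).homEquiv
      F G).symm a).hom.app (op ((Opens.map q).obj U)) = a.hom.app (op U) := by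
  have h := ((TopCat.Sheaf.pullbackPushforwardAdjunction AddCommGrpCat.{u} q).homEquiv
    F G).apply_symm_apply a
  rw [Adjunction.homEquiv_unit] at h
  exact congr_app (congrArg (fun c => c.hom) h) (op U)

open StalkSkyscraperPresheafAdjunctionAuxs in
/-- Both stalks represent maps from `F` to the skyscraper at `q w`, as the direct image of a
skyscraper sheaf is a skyscraper sheaf. -/
instance (q : W ⟶ Y) (F : Sh Y) (w : W) : IsIso (stalkPull q F w) := by
  let _ : ∀ U : Opens W, Decidable (w ∈ U) := fun _ => Classical.dec _
  let _ : ∀ U : Opens Y, Decidable (q w ∈ U) := fun U =>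
    inferInstanceAs (Decidable (w ∈ (Opens.map q).obj U))
  refine isIso_of_coyoneda_map_bijective _ fun A => ?_
  let e := (TopCat.Sheaf.pullbackPushforwardAdjunction AddCommGrpCat.{u} q).homEquiv F
    (skyscraperSheaf w A)
  have stalkPull_comp (d : F ⟶ (directImage q).obj (skyscraperSheaf w A)) :
      stalkPull q F w ≫ fromStalk w (e.symm d).hom =
        fromStalk (C := AddCommGrpCat.{u}) (c := A) (q w) d.hom := by
    refine F.presheaf.stalk_hom_ext fun U hU => ?_
    rw [← Category.assoc, germ_comp_stalkPull, Category.assoc]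
    refine (congrArg (pullSection q F U ≫ ·)
      (germ_fromStalk w (e.symm d).hom ((Opens.map q).obj U) hU)).trans ?_
    refine (Category.assoc _ _ _).symm.trans ((congrArg (· ≫ eqToHom _)
      (pullSection_comp_app_homEquiv_symm q d U)).trans ?_)
    exact (germ_fromStalk (q w) d.hom U hU).symm
  refine ⟨fun a b hab => ?_, fun c => ?_⟩
  · let toSkyscraper (c : ((inverseImage q).obj F).presheaf.stalk w ⟶ A) :
        (inverseImage q).obj F ⟶ skyscraperSheaf w A := ⟨toSkyscraperPresheaf w c⟩
    have hom_e (c) : (e (toSkyscraper c)).hom =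
        toSkyscraperPresheaf (q w) (stalkPull q F w ≫ c) := by
      have h := stalkPull_comp (e (toSkyscraper c))
      rw [e.symm_apply_apply] at h
      exact (to_skyscraper_fromStalk _ _).symm.trans (congrArg (toSkyscraperPresheaf (q w))
        (h.symm.trans (congrArg (stalkPull q F w ≫ ·) (fromStalk_to_skyscraper w c))))
    have h : e (toSkyscraper a) = e (toSkyscraper b) := ObjectProperty.hom_ext _
      ((hom_e a).trans ((congrArg (toSkyscraperPresheaf (q w)) hab).trans (hom_e b).symm))
    exact (fromStalk_to_skyscraper w a).symm.trans ((congrArg (fun d => fromStalk w d.hom)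
      (e.injective h)).trans (fromStalk_to_skyscraper w b))
  · let d : F ⟶ (directImage q).obj (skyscraperSheaf w A) :=
      ⟨(toSkyscraperPresheaf (q w) c : F.presheaf ⟶ skyscraperPresheaf (q w) A)⟩
    exact ⟨fromStalk w (e.symm d).hom,
      (stalkPull_comp d).trans (fromStalk_to_skyscraper (q w) c)⟩

lemma stalkPull_bijective (q : W ⟶ Y) (F : Sh Y) (w : W) : Function.Bijective (stalkPull q F w) :=
  ConcreteCategory.bijective_of_isIso _

lemma ContinuousSectionOn.stalkPull (q : W ⟶ Y) {F : Sh Y} {T : Type*} [TopologicalSpace T]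
    {ψ : T → W} {K : Set T} (hψ : ContinuousOn ψ K) {s : ∀ t, F.presheaf.stalk (q (ψ t))}
    (h : F.ContinuousSectionOn (fun t => q (ψ t)) s K) :
    ((inverseImage q).obj F).ContinuousSectionOn ψ (fun t => stalkPull q F (ψ t) (s t)) K :=
  .of_eventually_eq_germ hψ fun t ht => by
    obtain ⟨V, σ, hσ⟩ := h.eventually_eq_germ ht
    refine ⟨(Opens.map q).obj V, pullSection q F V σ, hσ.mono fun t' ⟨hV, e⟩ => ⟨hV, ?_⟩⟩
    rw [germ_pullSection q F (ψ t') hV, e]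

lemma continuousSectionOn_stalkPull_iff (q : W ⟶ Y) (F : Sh Y) {T : Type*} [TopologicalSpace T]
    {ψ : T → W} {K : Set T} (hψ : ContinuousOn ψ K) (s : ∀ t, F.presheaf.stalk (q (ψ t))) :
    ((inverseImage q).obj F).ContinuousSectionOn ψ (fun t => stalkPull q F (ψ t) (s t)) K ↔
      F.ContinuousSectionOn (fun t => q (ψ t)) s K :=
  ⟨.of_injective_comp (q.hom.continuous.comp_continuousOn hψ) (fun t => stalkPull q F (ψ t))
    (fun _ => (stalkPull_bijective q F _).1) fun _ _ hr hL => hr.stalkPull q (hψ.mono hL),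
    .stalkPull q hψ⟩

lemma stalkMap_stalkPull (q : W ⟶ Y) {F G : Sh Y} (a : F ⟶ G) (w : W)
    (s : F.presheaf.stalk (q w)) :
    stalkMap ((inverseImage q).map a) w (stalkPull q F w s) =
      stalkPull q G w (stalkMap a (q w) s) := by
  obtain ⟨U, hU, σ, rfl⟩ := F.presheaf.exists_germ_eq s
  rw [stalkMap_germ, ← germ_pullSection q F w hU, ← germ_pullSection q G w hU]
  refine (stalkMap_germ ((inverseImage q).map a) (U := (Opens.map q).obj U) hU _).trans ?_
  have h := congrArg (fun b => b.hom.app (op U))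
    ((TopCat.Sheaf.pullbackPushforwardAdjunction AddCommGrpCat.{u} q).unit.naturality a)
  exact congrArg _ (ConcreteCategory.congr_hom h σ).symm

end StalkPull

section Fiber

variable {X Y W Z : TopCat.{u}} {f : Y ⟶ X} {q : W ⟶ Y} {p : Z ⟶ X} {g : W ⟶ Z}
  (sq : IsPullback q g f p)

include sq

lemma exists_homeomorph_of_isPullback :
    ∃ e : W ≃ₜ {a : Y × Z // f a.1 = p a.2}, ∀ w, (e w).1.1 = q w ∧ (e w).1.2 = g w := by
  let e : W ≅ (TopCat.pullbackCone f p).pt :=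
    sq.isLimit.conePointUniqueUpToIso (TopCat.pullbackConeIsLimit f p)
  have hq : e.hom ≫ TopCat.pullbackFst f p = q :=
    sq.isLimit.conePointUniqueUpToIso_hom_comp (TopCat.pullbackConeIsLimit f p) .left
  have hg : e.hom ≫ TopCat.pullbackSnd f p = g :=
    sq.isLimit.conePointUniqueUpToIso_hom_comp (TopCat.pullbackConeIsLimit f p) .right
  exact ⟨(TopCat.homeoOfIso e : W ≃ₜ {a : Y × Z // f a.1 = p a.2}),
    fun w => ⟨ConcreteCategory.congr_hom hq w, ConcreteCategory.congr_hom hg w⟩⟩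

lemma isEmbedding_fiber_of_isPullback (z : Z) : IsEmbedding (fun t : g ⁻¹' {z} => q t.1) := by
  obtain ⟨e, he⟩ := exists_homeomorph_of_isPullback sq
  have hg (t : g ⁻¹' {z}) : g t.1 = z := t.2
  refine ⟨isInducing_iff_nhds.2 fun t => ?_, fun t t' h => ?_⟩
  · have hqt : (fun w => (e w).1.1) ∘ (Subtype.val : g ⁻¹' {z} → W) = fun t => q t.1 :=
      funext fun t => (he t.1).1
    have hgt : (fun w => (e w).1.2) ∘ (Subtype.val : g ⁻¹' {z} → W) = fun _ => z :=
      funext fun t => (he t.1).2.trans (hg t)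
    rw [nhds_subtype, nhds_eq_of_homeomorph e t.1, Filter.comap_inf, Filter.comap_comap,
      Filter.comap_comap, hqt, hgt, (he t.1).1, (he t.1).2, hg t]
    exact inf_eq_left.2 (le_top.trans (map_le_iff_le_comap.1 tendsto_const_nhds))
  · refine Subtype.ext (e.injective (Subtype.ext (Prod.ext ?_ ?_)))
    · rw [(he _).1, (he _).1]
      exact h
    · rw [(he _).2, (he _).2, hg, hg]

lemma range_fiber_of_isPullback (z : Z) :
    Set.range (fun t : g ⁻¹' {z} => q t.1) = f ⁻¹' {p z} := by
  obtain ⟨e, he⟩ := exists_homeomorph_of_isPullback sq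
  refine Set.Subset.antisymm ?_ fun y hy => ?_
  · rintro _ ⟨t, rfl⟩
    exact (ConcreteCategory.congr_hom sq.w t.1).trans (congrArg p t.2)
  · obtain ⟨w, hw⟩ := e.surjective ⟨(y, z), hy⟩
    exact ⟨⟨w, ((he w).2.symm.trans (by rw [hw]) : g w = z)⟩,
      ((he w).1.symm.trans (by rw [hw]) : q w = y)⟩

end Fiber

section FiberGerm

variable {X Y : TopCat.{u}} {f : Y ⟶ X} {F G : Sh Y} {x : X}

/-- The inclusion of the proper direct image into the direct image. -/
noncomputable def properDirectImageInclusion (f : Y ⟶ X) (F : Sh Y) :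
    (properDirectImage f).obj F ⟶ (directImage f).obj F :=
  ⟨{ app U := AddCommGrpCat.ofHom (properSections f F U.unop).subtype }⟩

/-- The germ at a point `y` of the fiber over `x` of an element of the stalk of `f_(!)F` at `x`.
For varying `y` this identifies the stalk with the sections of `F` along the fiber which have
compact support. -/
noncomputable def fiberGerm (F : Sh Y) {y : Y} (h : f y = x) :
    ((properDirectImage f).obj F).presheaf.stalk x ⟶ F.presheaf.stalk y :=
  stalkMap (properDirectImageInclusion f F) x ≫
    ((directImage f).obj F).presheaf.stalkSpecializes (specializes_of_eq h) ≫
      F.presheaf.stalkPushforward AddCommGrpCat.{u} f y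

lemma fiberGerm_germ {U : Opens X} (hx : x ∈ U) (σ : properSections f F U) {y : Y}
    (h : f y = x) (hy : f y ∈ U) :
    fiberGerm F h (((properDirectImage f).obj F).presheaf.germ U x hx σ) =
      F.presheaf.germ ((Opens.map f).obj U) y hy σ.1 := by
  have e := congrArg (((directImage f).obj F).presheaf.stalkSpecializes (specializes_of_eq h) ≫
    F.presheaf.stalkPushforward AddCommGrpCat.{u} f y)
      (stalkMap_germ (properDirectImageInclusion f F) hx σ)
  refine e.trans ?_
  have h₁ := TopCat.Presheaf.germ_stalkSpecializes ((directImage f).obj F).presheaf hx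
    (specializes_of_eq h)
  have h₂ := TopCat.Presheaf.stalkPushforward_germ AddCommGrpCat.{u} f F.presheaf U y hy
  exact (congrArg (F.presheaf.stalkPushforward AddCommGrpCat.{u} f y)
    (ConcreteCategory.congr_hom h₁ σ.1)).trans (ConcreteCategory.congr_hom h₂ σ.1)

lemma fiberGerm_stalkMap (k : F ⟶ G) {y : Y} (h : f y = x)
    (a : ((properDirectImage f).obj F).presheaf.stalk x) :
    fiberGerm G h (stalkMap ((properDirectImage f).map k) x a) =
      stalkMap k y (fiberGerm F h a) := by
  obtain ⟨U, hx, σ, rfl⟩ := ((properDirectImage f).obj F).presheaf.exists_germ_eq a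
  have hy : f y ∈ U := Set.mem_of_eq_of_mem (s := (U : Set X)) h hx
  rw [stalkMap_germ, fiberGerm_germ hx σ h hy]
  exact (fiberGerm_germ hx _ h hy).trans
    (stalkMap_germ k (U := (Opens.map f).obj U) hy σ.1).symm

lemma fiberGerm_ext {a b : ((properDirectImage f).obj F).presheaf.stalk x}
    (hab : ∀ (y : Y) (h : f y = x), fiberGerm F h a = fiberGerm F h b) : a = b := by
  rw [← sub_eq_zero]
  obtain ⟨U, hx, σ, hσ⟩ := ((properDirectImage f).obj F).presheaf.exists_germ_eq (a - b)
  obtain ⟨V, i, hxV, hV⟩ := exists_map_eq_zero_of_germ_fiber_eq_zero hx σ.2 fun y hy h => by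
    rw [← fiberGerm_germ hx σ h hy, hσ, map_sub, hab y h, sub_self]
  have hσV : ((properDirectImage f).obj F).presheaf.map i.op σ = 0 := Subtype.ext hV
  rw [← hσ, ← TopCat.Presheaf.germ_res_apply _ i x hxV σ, hσV, map_zero]

variable {T : Type*} [TopologicalSpace T] {φ : T → Y}

lemma compactlySupported_fiberGerm (hφ : IsEmbedding φ) (hφx : Set.range φ = f ⁻¹' {x})
    (h : ∀ t, f (φ t) = x) (a : ((properDirectImage f).obj F).presheaf.stalk x) :
    F.CompactlySupported φ fun t => fiberGerm F (h t) a := by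
  obtain ⟨U, hx, σ, rfl⟩ := ((properDirectImage f).obj F).presheaf.exists_germ_eq a
  exact compactlySupported_of_mem_properSections hφ hφx hx σ.2 fun t ht =>
    fiberGerm_germ hx σ (h t) ht

lemma CompactlySupported.exists_fiberGerm_eq {s : ∀ t, F.presheaf.stalk (φ t)}
    (hs : F.CompactlySupported φ s) (hf : IsSeparatedMap f) (hf' : IsLocallyProper f)
    (hφ : IsEmbedding φ) (hφx : Set.range φ = f ⁻¹' {x}) :
    ∃ a, ∀ (t : T) (h : f (φ t) = x), fiberGerm F h a = s t := by
  obtain ⟨U, hx, σ, hσ, hσs⟩ := exists_properSections_of_compactlySupported hf hf' hφ hφx hs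
  refine ⟨((properDirectImage f).obj F).presheaf.germ U x hx ⟨σ, hσ⟩, fun t h => ?_⟩
  have ht : f (φ t) ∈ U := Set.mem_of_eq_of_mem (s := (U : Set X)) h hx
  exact (fiberGerm_germ hx _ h ht).trans (hσs t ht)

end FiberGerm

section BaseChange

variable {X Y W Z : TopCat.{u}} {f : Y ⟶ X} {q : W ⟶ Y} {p : Z ⟶ X} {g : W ⟶ Z}
  (sq : IsPullback q g f p) (F : Sh Y)

/-- The pullback of a section of `f_(!)F` to a section of `g_(!)q^(*)F`. -/
noncomputable def baseChangeSection {U : Opens X} (σ : properSections f F U) :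
    properSections g ((inverseImage q).obj F) ((Opens.map p).obj U) :=
  ⟨((inverseImage q).obj F).presheaf.map (opensHom sq.w U).op
      (pullSection q F ((Opens.map f).obj U) σ.1),
    baseChange_mem sq _ U (hom_mem_properSections f
      ((TopCat.Sheaf.pullbackPushforwardAdjunction AddCommGrpCat.{u} q).unit.app F) σ.2)⟩

lemma germ_baseChangeSection {U : Opens X} (σ : properSections f F U) (w : W)
    (hw : p (g w) ∈ U) (hw' : f (q w) ∈ U) :
    ((inverseImage q).obj F).presheaf.germ _ w hw (baseChangeSection sq F σ).1 =
      stalkPull q F w (F.presheaf.germ ((Opens.map f).obj U) (q w) hw' σ.1) :=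
  (((inverseImage q).obj F).presheaf.germ_res_apply (opensHom sq.w U) w hw _).trans
    (germ_pullSection q F w (U := (Opens.map f).obj U) hw' σ.1)

lemma baseChange_app_pullSection {U : Opens X} (σ : properSections f F U) :
    ((baseChange sq).app F).hom.app (op ((Opens.map p).obj U))
        (pullSection p ((properDirectImage f).obj F) U σ) = baseChangeSection sq F σ :=
  ConcreteCategory.congr_hom (pullSection_comp_app_homEquiv_symm p
    ((properDirectImage f).map
      ((TopCat.Sheaf.pullbackPushforwardAdjunction AddCommGrpCat.{u} q).unit.app F) ≫
        (directBaseChange sq).app ((inverseImage q).obj F)) U) σ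

/-- The base change morphism `β` on the stalks at `p z` and `z`. -/
noncomputable def baseChangeStalk (z : Z) :
    ((properDirectImage f).obj F).presheaf.stalk (p z) ⟶
      ((properDirectImage g).obj ((inverseImage q).obj F)).presheaf.stalk z :=
  stalkPull p ((properDirectImage f).obj F) z ≫ stalkMap ((baseChange sq).app F) z

lemma baseChangeStalk_germ {U : Opens X} {z : Z} (hz : p z ∈ U) (σ : properSections f F U) :
    baseChangeStalk sq F z (((properDirectImage f).obj F).presheaf.germ U (p z) hz σ) =
      ((properDirectImage g).obj ((inverseImage q).obj F)).presheaf.germ ((Opens.map p).obj U) z hz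
        (baseChangeSection sq F σ) := by
  refine (congrArg _ (germ_pullSection p ((properDirectImage f).obj F) z hz σ).symm).trans ?_
  refine (stalkMap_germ ((baseChange sq).app F) (U := (Opens.map p).obj U) hz _).trans ?_
  exact congrArg _ (baseChange_app_pullSection sq F σ)

lemma fiberGerm_baseChangeStalk {w : W} {z : Z} (h : g w = z) (h' : f (q w) = p z)
    (a : ((properDirectImage f).obj F).presheaf.stalk (p z)) :
    fiberGerm ((inverseImage q).obj F) h (baseChangeStalk sq F z a) =
      stalkPull q F w (fiberGerm F h' a) := by
  obtain ⟨U, hU, σ, rfl⟩ := ((properDirectImage f).obj F).presheaf.exists_germ_eq a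
  have hw' : f (q w) ∈ U := Set.mem_of_eq_of_mem (s := (U : Set X)) h' hU
  have hw : p (g w) ∈ U := Set.mem_of_eq_of_mem (s := (U : Set X)) (congrArg p h) hU
  rw [baseChangeStalk_germ sq F hU σ, fiberGerm_germ hU σ h' hw',
    ← germ_baseChangeSection sq F σ w hw hw']
  exact fiberGerm_germ (U := (Opens.map p).obj U) hU _ h hw

lemma baseChangeStalk_injective (z : Z) : Function.Injective (baseChangeStalk sq F z) := by
  refine fun a b hab => fiberGerm_ext fun y hy => ?_
  obtain ⟨⟨w, hw⟩, rfl⟩ := (range_fiber_of_isPullback sq z).symm.subset hy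
  apply (stalkPull_bijective q F w).1
  rw [← fiberGerm_baseChangeStalk sq F hw hy, hab, fiberGerm_baseChangeStalk sq F hw hy]

lemma baseChangeStalk_surjective (hf : IsSeparatedMap f) (hf' : IsLocallyProper f) (z : Z) :
    Function.Surjective (baseChangeStalk sq F z) := by
  intro c
  choose s hs using fun t : g ⁻¹' {z} => (stalkPull_bijective q F t.1).2
    (fiberGerm ((inverseImage q).obj F) (t.2 : g t.1 = z) c)
  have hsc : ((inverseImage q).obj F).CompactlySupported (fun t : g ⁻¹' {z} => t.1)
      fun t => stalkPull q F t.1 (s t) := by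
    simpa only [hs] using compactlySupported_fiberGerm .subtypeVal Subtype.range_coe
      (fun t : g ⁻¹' {z} => t.2) c
  obtain ⟨K, hK, hsK⟩ := hsc.exists_isCompact
  have hsF : F.CompactlySupported (fun t : g ⁻¹' {z} => q t.1) s :=
    ⟨(continuousSectionOn_stalkPull_iff q F continuous_subtype_val.continuousOn s).1
      hsc.continuousSectionOn, K, hK, fun t ht =>
        (stalkPull_bijective q F t.1).1 ((hsK t ht).trans (map_zero _).symm)⟩
  obtain ⟨a, ha⟩ := hsF.exists_fiberGerm_eq hf hf' (isEmbedding_fiber_of_isPullback sq z)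
    (range_fiber_of_isPullback sq z)
  refine ⟨a, fiberGerm_ext fun w hw => ?_⟩
  have hw' : f (q w) = p z := (ConcreteCategory.congr_hom sq.w w).trans (congrArg p hw)
  rw [fiberGerm_baseChangeStalk sq F hw hw', ha ⟨w, hw⟩ hw']
  exact hs ⟨w, hw⟩

lemma isIso_baseChange (hf : IsSeparatedMap f) (hf' : IsLocallyProper f) :
    IsIso (baseChange sq) := by
  refine @NatIso.isIso_of_isIso_app _ _ _ _ _ _ _ fun F => ?_
  rw [TopCat.Presheaf.isIso_iff_stalkFunctor_map_iso]
  intro z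
  have : IsIso (stalkPull p ((properDirectImage f).obj F) z ≫
      (TopCat.Presheaf.stalkFunctor AddCommGrpCat.{u} z).map ((baseChange sq).app F).hom) :=
    (ConcreteCategory.isIso_iff_bijective _).2
      ⟨baseChangeStalk_injective sq F z, baseChangeStalk_surjective sq F hf hf' z⟩
  exact IsIso.of_isIso_comp_left (stalkPull p ((properDirectImage f).obj F) z) _

end BaseChange

section Stalk

variable {Y W : TopCat.{u}}

/-- The stalks at `y` of a complex of sheaves. -/
noncomputable abbrev stalkShortComplex (S : ShortComplex (Sh Y)) (y : Y) :
    ShortComplex AddCommGrpCat.{u} :=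
  S.map (TopCat.Sheaf.forget AddCommGrpCat.{u} Y ⋙
    TopCat.Presheaf.stalkFunctor AddCommGrpCat.{u} y)

lemma shortExact_iff_stalkShortComplex (S : ShortComplex (Sh Y)) :
    S.ShortExact ↔ ∀ y, (stalkShortComplex S y).ShortExact where
  mp hS _ := hS.map_of_exact _
  mpr h :=
    { exact := (TopCat.Sheaf.exact_iff_stalkFunctor_map_exact S).2 fun y => (h y).exact
      mono_f := (TopCat.Presheaf.mono_iff_stalk_mono S.f).2 fun y => (h y).mono_f
      epi_g := (TopCat.Sheaf.isLocallySurjective_iff_epi S.g).1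
        (TopCat.Presheaf.locally_surjective_iff_surjective_on_stalks S.g.hom |>.2
          fun y => (h y).ab_surjective_g) }

lemma stalkMap_comp {F G H : Sh Y} (a : F ⟶ G) (b : G ⟶ H) (y : Y) (s : F.presheaf.stalk y) :
    stalkMap (a ≫ b) y s = stalkMap b y (stalkMap a y s) :=
  ConcreteCategory.congr_hom
    ((TopCat.Presheaf.stalkFunctor AddCommGrpCat.{u} y).map_comp a.hom b.hom) s

lemma stalkMap_add {F G : Sh Y} (a b : F ⟶ G) (y : Y) (s : F.presheaf.stalk y) :
    stalkMap (a + b) y s = stalkMap a y s + stalkMap b y s := by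
  obtain ⟨U, hU, σ, rfl⟩ := F.presheaf.exists_germ_eq s
  refine (stalkMap_germ _ hU σ).trans ?_
  rw [stalkMap_germ, stalkMap_germ, ← map_add]
  rfl

lemma stalkMap_id (F : Sh Y) (y : Y) (s : F.presheaf.stalk y) : stalkMap (𝟙 F) y s = s :=
  ConcreteCategory.congr_hom
    ((TopCat.Presheaf.stalkFunctor AddCommGrpCat.{u} y).map_id F.presheaf) s

/-- The stalks of the inverse image of a complex are those of the complex. -/
noncomputable def stalkShortComplexInverseImageIso (q : W ⟶ Y) (S : ShortComplex (Sh Y)) (w : W) :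
    stalkShortComplex S (q w) ≅ stalkShortComplex (S.map (inverseImage q)) w :=
  let e (F : Sh Y) := asIso (stalkPull q F w)
  ShortComplex.isoMk (e S.X₁) (e S.X₂) (e S.X₃)
    (ConcreteCategory.hom_ext _ _ fun s => stalkMap_stalkPull q S.f w s)
    (ConcreteCategory.hom_ext _ _ fun s => stalkMap_stalkPull q S.g w s)

lemma shortExact_map_inverseImage (q : W ⟶ Y) {S : ShortComplex (Sh Y)} (hS : S.ShortExact) :
    (S.map (inverseImage q)).ShortExact :=
  (shortExact_iff_stalkShortComplex _).2 fun w =>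
    ShortComplex.shortExact_of_iso (stalkShortComplexInverseImageIso q S w)
      ((shortExact_iff_stalkShortComplex S).1 hS (q w))

end Stalk

section Flasque

variable {Y : TopCat.{u}}

/-- The functor sending an open subset `U` to the sheaf `ℤ_U` which represents the sections
over `U`. -/
noncomputable def freeOpen (Y : TopCat.{u}) : Opens Y ⥤ Sh Y :=
  yoneda ⋙ (Functor.whiskeringRight _ _ _).obj AddCommGrpCat.free.{u} ⋙
    presheafToSheaf (Opens.grothendieckTopology Y) AddCommGrpCat.{u}

/-- Morphisms from `ℤ_U` to a sheaf are the sections of this sheaf over `U`. -/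
noncomputable def freeOpenHomEquiv (F : Sh Y) (U : Opens Y) :
    ((freeOpen Y).obj U ⟶ F) ≃ F.obj.obj (op U) :=
  ((sheafificationAdjunction (Opens.grothendieckTopology Y) AddCommGrpCat.{u}).homEquiv _ F).trans
    (((AddCommGrpCat.adj.{u}.whiskerRight (Opens Y)ᵒᵖ).homEquiv (yoneda.obj U) F.obj).trans
      yonedaEquiv)

lemma freeOpenHomEquiv_naturality (F : Sh Y) {U V : Opens Y} (i : V ⟶ U)
    (a : (freeOpen Y).obj U ⟶ F) :
    freeOpenHomEquiv F V ((freeOpen Y).map i ≫ a) = F.obj.map i.op (freeOpenHomEquiv F U a) := by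
  have h₁ := (sheafificationAdjunction (Opens.grothendieckTopology Y)
    AddCommGrpCat.{u}).homEquiv_naturality_left
      (((Functor.whiskeringRight _ _ _).obj AddCommGrpCat.free.{u}).map (yoneda.map i)) a
  have h₂ := (AddCommGrpCat.adj.{u}.whiskerRight (Opens Y)ᵒᵖ).homEquiv_naturality_left
    (yoneda.map i) ((sheafificationAdjunction (Opens.grothendieckTopology Y)
      AddCommGrpCat.{u}).homEquiv _ F a)
  exact (congrArg _ (congrArg _ h₁)).trans ((congrArg _ h₂).trans (yonedaEquiv_naturality _ i).symm)

instance mono_freeOpen_map {U V : Opens Y} (i : V ⟶ U) : Mono ((freeOpen Y).map i) := by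
  let F := (Functor.whiskeringRight (Opens Y)ᵒᵖ _ _).obj AddCommGrpCat.free.{u}
  have (T : (Opens Y)ᵒᵖ) : Mono ((F.map (yoneda.map i)).app T) :=
    inferInstanceAs (Mono (AddCommGrpCat.free.{u}.map ((yoneda.map i).app T)))
  have := NatTrans.mono_of_mono_app (F.map (yoneda.map i))
  exact inferInstanceAs (Mono ((presheafToSheaf (Opens.grothendieckTopology Y)
    AddCommGrpCat.{u}).map (F.map (yoneda.map i))))

instance isFlasque_of_injective (I : Sh Y) [Injective I] : TopCat.Sheaf.IsFlasque I where
  epi {U V} i := (AddCommGrpCat.epi_iff_surjective _).2 fun σ => by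
    let a := (freeOpenHomEquiv I V.unop).symm σ
    refine ⟨freeOpenHomEquiv I U.unop (Injective.factorThru a ((freeOpen Y).map i.unop)),
      (freeOpenHomEquiv_naturality I i.unop _).symm.trans ?_⟩
    rw [Injective.comp_factorThru, Equiv.apply_symm_apply]

end Flasque

section Soft

variable {Y W : TopCat.{u}} {T : Type*} [TopologicalSpace T]

/-- A sheaf is soft along `φ` if its sections on compact subsets along `φ` extend. For the
inclusion of a locally compact Hausdorff subspace this is c-softness of the restriction. -/
def IsSoftAlong (F : Sh Y) (φ : T → Y) : Prop :=
  ∀ (K : Set T) (s : ∀ t, F.presheaf.stalk (φ t)), IsCompact K → F.ContinuousSectionOn φ s K →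
    ∃ s' : ∀ t, F.presheaf.stalk (φ t),
      F.ContinuousSectionOn φ s' Set.univ ∧ ∀ t ∈ K, s' t = s t

lemma isSoftAlong_of_isFlasque [LocallyCompactSpace T] (F : Sh Y) [TopCat.Sheaf.IsFlasque F]
    {φ : T → Y} (hφ : Continuous φ) (hd : Pairwise fun t t' => Disjoint (𝓝 (φ t)) (𝓝 (φ t'))) :
    F.IsSoftAlong φ := by
  intro K s hK hs
  obtain ⟨O, r, hr, hrs⟩ := hs.extendsToNhd hφ hd hK
  obtain ⟨σ, hσ⟩ := hr.exists_germ_eq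
  let i : O ⟶ ⊤ := homOfLE le_top
  obtain ⟨τ, hτ⟩ := (AddCommGrpCat.epi_iff_surjective _).1
    (TopCat.Presheaf.IsFlasque.epi (F := F.presheaf) i.op) σ
  refine ⟨fun t => F.presheaf.germ ⊤ (φ t) trivial τ,
    .of_germ τ hφ.continuousOn fun t _ => ⟨trivial, rfl⟩, fun t ht => ?_⟩
  obtain ⟨htO, hrt⟩ := hrs t ht
  rw [← hrt, ← hσ _ htO, ← hτ]
  exact (F.presheaf.germ_res_apply i _ _ _).symm

lemma IsSoftAlong.inverseImage {F : Sh Y} {q : W ⟶ Y} {ψ : T → W} (hψ : Continuous ψ)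
    (h : F.IsSoftAlong fun t => q (ψ t)) : ((inverseImage q).obj F).IsSoftAlong ψ := by
  intro K s hK hs
  choose r hr using fun t => (stalkPull_bijective q F (ψ t)).2 (s t)
  obtain ⟨r', hr', e⟩ := h K r hK ((continuousSectionOn_stalkPull_iff q F hψ.continuousOn r).1
    (hs.congr fun t _ => hr t))
  exact ⟨fun t => stalkPull q F (ψ t) (r' t),
    (continuousSectionOn_stalkPull_iff q F hψ.continuousOn r').2 hr',
    fun t ht => (congrArg _ (e t ht)).trans (hr t)⟩

lemma IsSoftAlong.biprod {F G : Sh Y} {φ : T → Y} (hF : F.IsSoftAlong φ) (hG : G.IsSoftAlong φ) :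
    (F ⊞ G).IsSoftAlong φ := by
  intro K s hK hs
  obtain ⟨a, ha, ha'⟩ := hF K _ hK (hs.map (biprod.fst : F ⊞ G ⟶ F))
  obtain ⟨b, hb, hb'⟩ := hG K _ hK (hs.map (biprod.snd : F ⊞ G ⟶ G))
  refine ⟨_, (ha.map (biprod.inl : F ⟶ F ⊞ G)).add (hb.map (biprod.inr : G ⟶ F ⊞ G)),
    fun t ht => ?_⟩
  rw [ha' t ht, hb' t ht, ← stalkMap_comp, ← stalkMap_comp, ← stalkMap_add, biprod.total,
    stalkMap_id]

end Soft

section Lift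

variable {Y : TopCat.{u}} {T : Type*} [TopologicalSpace T] {φ : T → Y}

/-- The section `c` of `G` along `φ` lifts on `K` to a continuous section of `F`. -/
def LiftsOn {F G : Sh Y} (k : F ⟶ G) (c : ∀ t, G.presheaf.stalk (φ t)) (K : Set T) : Prop :=
  ∃ b : ∀ t, F.presheaf.stalk (φ t), F.ContinuousSectionOn φ b K ∧
    ∀ t ∈ K, stalkMap k (φ t) (b t) = c t

lemma LiftsOn.mono {F G : Sh Y} {k : F ⟶ G} {c : ∀ t, G.presheaf.stalk (φ t)} {K L : Set T}
    (h : LiftsOn k c K) (hLK : L ⊆ K) : LiftsOn k c L :=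
  let ⟨b, hb, hbc⟩ := h
  ⟨b, hb.mono hLK, fun t ht => hbc t (hLK ht)⟩

lemma exists_liftsOn_nhdsWithin {F G : Sh Y} {k : F ⟶ G}
    (hk : ∀ y, Function.Surjective (stalkMap k y)) {c : ∀ t, G.presheaf.stalk (φ t)} {K : Set T}
    (hc : G.ContinuousSectionOn φ c K) {t : T} (ht : t ∈ K) :
    ∃ L ∈ 𝓝[K] t, LiftsOn k c L := by
  obtain ⟨b₀, hb₀⟩ := hk (φ t) (c t)
  obtain ⟨L, hL, hLK, b, hb, rfl⟩ := F.exists_continuousSectionOn_apply_eq hc.continuousOn ht b₀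
  have hbc := (hb.map k).eventually_eq (hc.mono hLK) (mem_of_mem_nhdsWithin ht hL) hb₀
  exact ⟨_, inter_mem hL (nhdsWithin_le_of_mem hL hbc), b, hb.mono Set.inter_subset_left,
    fun t' ht' => ht'.2⟩

variable {S : ShortComplex (Sh Y)} (hS : S.ShortExact)

include hS

lemma stalkMap_injective (y : Y) : Function.Injective (stalkMap S.f y) :=
  ((shortExact_iff_stalkShortComplex S).1 hS y).ab_injective_f

lemma stalkMap_surjective (y : Y) : Function.Surjective (stalkMap S.g y) :=
  ((shortExact_iff_stalkShortComplex S).1 hS y).ab_surjective_g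

omit hS in
lemma stalkMap_stalkMap_eq_zero (S : ShortComplex (Sh Y)) (y : Y) (a : S.X₁.presheaf.stalk y) :
    stalkMap S.g y (stalkMap S.f y a) = 0 :=
  (stalkShortComplex S y).ab_zero_apply a

lemma ContinuousSectionOn.liftsOn_kernel {K : Set T} {b : ∀ t, S.X₂.presheaf.stalk (φ t)}
    (hb : S.X₂.ContinuousSectionOn φ b K) (h₀ : ∀ t ∈ K, stalkMap S.g (φ t) (b t) = 0) :
    LiftsOn S.f b K := by
  choose! a ha using fun t (h : stalkMap S.g (φ t) (b t) = 0) =>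
    (ShortComplex.ab_exact_iff _).1 ((shortExact_iff_stalkShortComplex S).1 hS (φ t)).exact (b t) h
  exact ⟨a, .of_injective_comp hb.continuousOn (fun t => stalkMap S.f (φ t))
    (fun t => stalkMap_injective hS (φ t)) (fun _ _ hr _ => hr.map S.f)
    (hb.congr fun t ht => ha t (h₀ t ht)), fun t ht => ha t (h₀ t ht)⟩

/-- On the overlap the two lifts differ by a section of the kernel, and softness extends this
difference so that the second lift can be corrected by it. -/
lemma LiftsOn.union (hA : S.X₁.IsSoftAlong φ) {c : ∀ t, S.X₃.presheaf.stalk (φ t)} {C C' : Set T}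
    (hC : IsClosed C) (hC' : IsClosed C') (hCC' : IsCompact (C ∩ C'))
    (h : LiftsOn S.g c C) (h' : LiftsOn S.g c C') : LiftsOn S.g c (C ∪ C') := by
  classical
  obtain ⟨b, hb, hbc⟩ := h
  obtain ⟨b', hb', hbc'⟩ := h'
  obtain ⟨a, ha, hab⟩ := ContinuousSectionOn.liftsOn_kernel hS
    ((hb.mono (Set.inter_subset_left (t := C'))).sub (hb'.mono Set.inter_subset_right))
    (fun t ht => by rw [map_sub, hbc t ht.1, hbc' t ht.2, sub_self])
  obtain ⟨e, he, hea⟩ := hA _ a hCC' ha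
  let d (t : T) := if t ∈ C then b t else b' t + stalkMap S.f (φ t) (e t)
  have hd : ∀ t ∈ C, d t = b t := fun t ht => if_pos ht
  have hd' : ∀ t ∈ C', d t = b' t + stalkMap S.f (φ t) (e t) := fun t ht => by
    by_cases htC : t ∈ C
    · rw [hd t htC, hea t ⟨htC, ht⟩, hab t ⟨htC, ht⟩, add_sub_cancel]
    · exact if_neg htC
  refine ⟨d, (hb.congr hd).union_of_isClosed ((hb'.add
    ((he.map S.f).mono (Set.subset_univ _))).congr hd') hC hC', ?_⟩
  rintro t (ht | ht)
  · rw [hd t ht, hbc t ht]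
  · rw [hd' t ht, map_add, hbc' t ht, stalkMap_stalkMap_eq_zero, add_zero]

lemma ContinuousSectionOn.liftsOn_of_isCompact [T2Space T] [LocallyCompactSpace T]
    (hA : S.X₁.IsSoftAlong φ) {K : Set T} (hK : IsCompact K) {c : ∀ t, S.X₃.presheaf.stalk (φ t)}
    (hc : S.X₃.ContinuousSectionOn φ c K) : LiftsOn S.g c K := by
  suffices ∃ C : Set T, IsCompact C ∧ K ∩ K ⊆ C ∧ LiftsOn S.g c C by
    obtain ⟨C, -, hKC, h⟩ := this
    exact h.mono (Set.inter_self K ▸ hKC)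
  refine hK.induction_on (p := fun R => ∃ C : Set T, IsCompact C ∧ R ∩ K ⊆ C ∧ LiftsOn S.g c C)
    ⟨∅, isCompact_empty, (Set.empty_inter K).subset, 0, continuousOn_empty _, by simp⟩ ?_ ?_ ?_
  · rintro R R' hR ⟨C, hC, hRC, h⟩
    exact ⟨C, hC, (Set.inter_subset_inter_left _ hR).trans hRC, h⟩
  · rintro R R' ⟨C, hC, hRC, h⟩ ⟨C', hC', hRC', h'⟩
    exact ⟨C ∪ C', hC.union hC', Set.union_inter_distrib_right R R' K ▸
      Set.union_subset_union hRC hRC',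
      LiftsOn.union hS hA hC.isClosed hC'.isClosed (hC.inter hC') h h'⟩
  · intro t ht
    obtain ⟨L, hL, h⟩ := exists_liftsOn_nhdsWithin (stalkMap_surjective hS) hc ht
    obtain ⟨N, hN, hNL⟩ := mem_nhdsWithin_iff_exists_mem_nhds_inter.1 hL
    obtain ⟨C, hC, hCN, hCc⟩ := LocallyCompactSpace.local_compact_nhds t N hN
    exact ⟨C, mem_nhdsWithin_of_mem_nhds hC, C ∩ K, hCc.inter_right hK.isClosed, subset_rfl,
      h.mono ((Set.inter_subset_inter_left K hCN).trans hNL)⟩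

lemma IsSoftAlong.of_shortExact [T2Space T] [LocallyCompactSpace T] (hA : S.X₁.IsSoftAlong φ)
    (hB : S.X₂.IsSoftAlong φ) : S.X₃.IsSoftAlong φ := by
  intro K c hK hc
  obtain ⟨b, hb, hbc⟩ := ContinuousSectionOn.liftsOn_of_isCompact hS hA hK hc
  obtain ⟨b', hb', e⟩ := hB K b hK hb
  exact ⟨_, hb'.map S.g, fun t ht => (congrArg _ (e t ht)).trans (hbc t ht)⟩

lemma CompactlySupported.exists_kernel_lift {b : ∀ t, S.X₂.presheaf.stalk (φ t)}
    (hb : S.X₂.CompactlySupported φ b) (h₀ : ∀ t, stalkMap S.g (φ t) (b t) = 0) :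
    ∃ a, S.X₁.CompactlySupported φ a ∧ ∀ t, stalkMap S.f (φ t) (a t) = b t := by
  obtain ⟨a, ha, hab⟩ := ContinuousSectionOn.liftsOn_kernel hS hb.continuousSectionOn
    fun t _ => h₀ t
  obtain ⟨K, hK, hbK⟩ := hb.exists_isCompact
  refine ⟨a, ⟨ha, K, hK, fun t ht => stalkMap_injective hS (φ t) ?_⟩, fun t => hab t trivial⟩
  rw [hab t trivial, hbK t ht, map_zero]

/-- A lift on a compact neighborhood `L` of the support takes values in the kernel on the frontier
of `L`; softness allows to modify it such that it vanishes there. -/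
lemma CompactlySupported.exists_lift [T2Space T] [LocallyCompactSpace T]
    (hA : S.X₁.IsSoftAlong φ) {c : ∀ t, S.X₃.presheaf.stalk (φ t)}
    (hc : S.X₃.CompactlySupported φ c) :
    ∃ b, S.X₂.CompactlySupported φ b ∧ ∀ t, stalkMap S.g (φ t) (b t) = c t := by
  classical
  obtain ⟨K, hK, hcK⟩ := hc.exists_isCompact
  obtain ⟨L, hL, hKL⟩ := exists_compact_superset hK
  obtain ⟨b, hb, hbc⟩ := ContinuousSectionOn.liftsOn_of_isCompact hS hA hL
    (hc.continuousSectionOn.mono (Set.subset_univ _))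
  have hfr : frontier L ⊆ L := hL.isClosed.frontier_subset
  obtain ⟨a, ha, hab⟩ := ContinuousSectionOn.liftsOn_kernel hS (hb.mono hfr) (fun t ht => by
    rw [hbc t (hfr ht), hcK t fun h => ht.2 (hKL h)])
  obtain ⟨e, he, hea⟩ := hA _ a (hL.of_isClosed_subset isClosed_frontier hfr) ha
  let d (t : T) := if t ∈ L then b t - stalkMap S.f (φ t) (e t) else 0
  have hd : ∀ t ∈ L, d t = b t - stalkMap S.f (φ t) (e t) := fun t ht => if_pos ht
  have hd₀ : ∀ t ∈ (interior L)ᶜ, d t = 0 := fun t ht => by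
    by_cases htL : t ∈ L
    · have htfr : t ∈ frontier L := ⟨subset_closure htL, ht⟩
      rw [hd t htL, hea t htfr, hab t htfr, sub_self]
    · exact if_neg htL
  refine ⟨d, ⟨?_, L, hL, fun t ht => if_neg ht⟩, fun t => ?_⟩
  · have hcover : Set.univ ⊆ L ∪ (interior L)ᶜ := fun t _ =>
      (em (t ∈ interior L)).imp_left fun ht => interior_subset ht
    exact (((hb.sub ((he.map S.f).mono (Set.subset_univ _))).congr hd).union_of_isClosed
      ((ContinuousSectionOn.zero S.X₂ (hc.continuousSectionOn.continuousOn.mono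
        (Set.subset_univ _))).congr hd₀) hL.isClosed isOpen_interior.isClosed_compl).mono hcover
  · by_cases ht : t ∈ L
    · rw [hd t ht, map_sub, hbc t ht, stalkMap_stalkMap_eq_zero, sub_zero]
    · rw [hcK t fun h => ht (interior_subset (hKL h)), show d t = 0 from if_neg ht, map_zero]

end Lift

section SoftOnFibers

variable {X Y W Z : TopCat.{u}} {f : Y ⟶ X} {q : W ⟶ Y} {p : Z ⟶ X} {g : W ⟶ Z}

/-- The sheaves which are soft on all the fibers of a map. On these sheaves the proper direct image
along the map is exact. -/
def IsSoftOnFibers (g : W ⟶ Z) : ObjectProperty (Sh W) :=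
  fun F => ∀ z : Z, F.IsSoftAlong fun t : g ⁻¹' {z} => t.1

lemma isSoftOnFibers_of_isFlasque (hg : IsSeparatedMap g) (hg' : IsLocallyProper g) (F : Sh W)
    [TopCat.Sheaf.IsFlasque F] : IsSoftOnFibers g F := fun z => by
  have := hg'.locallyCompactSpace_fiber z
  exact isSoftAlong_of_isFlasque F continuous_subtype_val fun t t' h =>
    isSeparatedMap_iff_disjoint_nhds.1 hg _ _ (t.2.trans t'.2.symm) (Subtype.coe_injective.ne h)

lemma isSoftOnFibers_inverseImage_of_isFlasque (sq : IsPullback q g f p) (hf : IsSeparatedMap f)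
    (hg : IsLocallyProper g) (F : Sh Y) [TopCat.Sheaf.IsFlasque F] :
    IsSoftOnFibers g ((inverseImage q).obj F) := fun z => by
  have := hg.locallyCompactSpace_fiber z
  have hφ := isEmbedding_fiber_of_isPullback sq z
  have hφz (t : g ⁻¹' {z}) : f (q t.1) = p z :=
    (range_fiber_of_isPullback sq z).subset (Set.mem_range_self t)
  exact .inverseImage continuous_subtype_val (isSoftAlong_of_isFlasque F hφ.continuous
    fun t t' h => isSeparatedMap_iff_disjoint_nhds.1 hf _ _ ((hφz t).trans (hφz t').symm)
      (hφ.injective.ne h))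

lemma isSoftOnFibers_of_shortExact (hg : IsSeparatedMap g) (hg' : IsLocallyProper g)
    {S : ShortComplex (Sh W)} (hS : S.ShortExact) (h₁ : IsSoftOnFibers g S.X₁)
    (h₂ : IsSoftOnFibers g S.X₂) : IsSoftOnFibers g S.X₃ := fun z => by
  have := hg'.locallyCompactSpace_fiber z
  have := t2Space_fiber_of_isSeparatedMap hg z
  exact .of_shortExact hS (h₁ z) (h₂ z)

lemma isSoftOnFibers_biprod {F G : Sh W} (hF : IsSoftOnFibers g F) (hG : IsSoftOnFibers g G) :
    IsSoftOnFibers g (F ⊞ G) := fun z => (hF z).biprod (hG z)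

section ShortExact

variable {S : ShortComplex (Sh W)} (hS : S.ShortExact) {z : Z}

include hS

lemma stalkMap_properDirectImage_injective :
    Function.Injective (stalkMap ((properDirectImage g).map S.f) z) := by
  refine fun a b hab => fiberGerm_ext fun w hw => stalkMap_injective hS w ?_
  rw [← fiberGerm_stalkMap, hab, fiberGerm_stalkMap]

lemma exists_stalkMap_properDirectImage_eq (hg : IsSeparatedMap g) (hg' : IsLocallyProper g)
    {b : ((properDirectImage g).obj S.X₂).presheaf.stalk z}
    (hb : stalkMap ((properDirectImage g).map S.g) z b = 0) :
    ∃ a, stalkMap ((properDirectImage g).map S.f) z a = b := by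
  obtain ⟨a, ha, hab⟩ := CompactlySupported.exists_kernel_lift hS
    (compactlySupported_fiberGerm .subtypeVal Subtype.range_coe (fun t : g ⁻¹' {z} => t.2) b)
    fun t => (fiberGerm_stalkMap S.g t.2 b).symm.trans ((congrArg _ hb).trans (map_zero _))
  obtain ⟨α, hα⟩ := ha.exists_fiberGerm_eq hg hg' .subtypeVal Subtype.range_coe
  refine ⟨α, fiberGerm_ext fun w hw => ?_⟩
  rw [fiberGerm_stalkMap, hα ⟨w, hw⟩ hw]
  exact hab ⟨w, hw⟩

lemma stalkMap_properDirectImage_surjective (hg : IsSeparatedMap g) (hg' : IsLocallyProper g)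
    (h₁ : IsSoftOnFibers g S.X₁) :
    Function.Surjective (stalkMap ((properDirectImage g).map S.g) z) := by
  intro c
  have := hg'.locallyCompactSpace_fiber z
  have := t2Space_fiber_of_isSeparatedMap hg z
  obtain ⟨b, hb, hbc⟩ := CompactlySupported.exists_lift hS (h₁ z)
    (compactlySupported_fiberGerm .subtypeVal Subtype.range_coe (fun t : g ⁻¹' {z} => t.2) c)
  obtain ⟨β, hβ⟩ := hb.exists_fiberGerm_eq hg hg' .subtypeVal Subtype.range_coe
  refine ⟨β, fiberGerm_ext fun w hw => ?_⟩
  rw [fiberGerm_stalkMap, hβ ⟨w, hw⟩ hw]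
  exact hbc ⟨w, hw⟩

lemma shortExact_map_properDirectImage (hg : IsSeparatedMap g) (hg' : IsLocallyProper g)
    (h₁ : IsSoftOnFibers g S.X₁) : (S.map (properDirectImage g)).ShortExact :=
  (shortExact_iff_stalkShortComplex _).2 fun _ =>
    { exact := (ShortComplex.ab_exact_iff _).2 fun _ =>
        exists_stalkMap_properDirectImage_eq hS hg hg'
      mono_f := (AddCommGrpCat.mono_iff_injective _).2 (stalkMap_properDirectImage_injective hS)
      epi_g := (AddCommGrpCat.epi_iff_surjective _).2
        (stalkMap_properDirectImage_surjective hS hg hg' h₁) }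

end ShortExact

end SoftOnFibers

end Sh

section Adapted

open ZeroObject

variable {C D : Type*} [Category* C] [Category* D] [Abelian C] [Abelian D]

/-- A class of objects `P` is adapted to a functor `F` if it contains the injective objects, is
closed under binary biproducts and cokernels of monomorphisms, and if `F` is exact on the short
exact sequences whose first term is in `P`. The right derived functors of `F` may then be computed
by resolutions with terms in `P`. -/
structure IsAdapted (P : ObjectProperty C) (F : C ⥤ D) [F.Additive] : Prop where
  of_injective (I : C) [Injective I] : P I
  biprod {A B : C} : P A → P B → P (A ⊞ B)
  of_shortExact {S : ShortComplex C} : S.ShortExact → P S.X₁ → P S.X₂ → P S.X₃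
  map_shortExact {S : ShortComplex C} : S.ShortExact → P S.X₁ → (S.map F).ShortExact

/-- The short complex `Zⁱ ⟶ Kⁱ ⟶ Zʲ` of a cochain complex `K`, where `Zⁱ` is the object of
`i`-cocycles. For `j = i + 1` and `K` acyclic it is short exact. -/
noncomputable abbrev cyclesShortComplex (K : CochainComplex C ℤ) (i j : ℤ) : ShortComplex C :=
  ShortComplex.mk (K.iCycles i) (K.toCycles i j) (by
    rw [← cancel_mono (K.iCycles j), Category.assoc, K.toCycles_i, K.iCycles_d, zero_comp])

lemma shortExact_cyclesShortComplex {K : CochainComplex C ℤ} (hK : K.Acyclic) (i : ℤ) :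
    (cyclesShortComplex K i (i + 1)).ShortExact where
  exact := ShortComplex.exact_of_f_is_kernel _
    (isKernelOfComp (K.iCycles (i + 1)) _ (K.cyclesIsKernel i (i + 1) (by simp)) _
      (K.toCycles_i i (i + 1)))
  mono_f := inferInstanceAs (Mono (K.iCycles i))
  epi_g := by
    have h (j : ℤ) (hj : (ComplexShape.up ℤ).prev (i + 1) = j) : Epi (K.toCycles j (i + 1)) := by
      subst hj
      exact (hK (i + 1)).epi_toCycles
    exact h i (by simp)

lemma exact_epi_comp_comp_mono {S : ShortComplex C} (hS : S.Exact) {A B : C} (e : A ⟶ S.X₁) [Epi e]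
    (m : S.X₃ ⟶ B) [Mono m] :
    (ShortComplex.mk (e ≫ S.f) (S.g ≫ m) (by simp)).Exact := by
  let T := ShortComplex.mk S.f (S.g ≫ m) (by simp)
  let φ : S ⟶ T := { τ₁ := 𝟙 _, τ₂ := 𝟙 _, τ₃ := m }
  let ψ : ShortComplex.mk (e ≫ S.f) (S.g ≫ m) (by simp) ⟶ T :=
    { τ₁ := e, τ₂ := 𝟙 _, τ₃ := 𝟙 _ }
  have : Epi φ.τ₁ := inferInstanceAs (Epi (𝟙 _))
  have : IsIso φ.τ₂ := inferInstanceAs (IsIso (𝟙 _))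
  have : Mono φ.τ₃ := inferInstanceAs (Mono m)
  have : Epi ψ.τ₁ := inferInstanceAs (Epi e)
  have : IsIso ψ.τ₂ := inferInstanceAs (IsIso (𝟙 _))
  have : Mono ψ.τ₃ := inferInstanceAs (Mono (𝟙 _))
  rw [ShortComplex.exact_iff_of_epi_of_isIso_of_mono ψ]
  exact (ShortComplex.exact_iff_of_epi_of_isIso_of_mono φ).1 hS

lemma quasiIso_iff_acyclic_mappingCone {K L : CochainComplex C ℤ} (φ : K ⟶ L) :
    QuasiIso φ ↔ (CochainComplex.mappingCone φ).Acyclic := by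
  rw [← HomologicalComplex.mem_quasiIso_iff, ← HomotopyCategory.quotient_map_mem_quasiIso_iff,
    HomotopyCategory.quasiIso_eq_trW_subcategoryAcyclic,
    ← HomotopyCategory.quotient_obj_mem_subcategoryAcyclic_iff_acyclic]
  exact (HomotopyCategory.subcategoryAcyclic C).trW_iff_of_distinguished _
    (HomotopyCategory.mappingCone_triangleh_distinguished φ)

namespace IsAdapted

variable {P : ObjectProperty C} {F : C ⥤ D} [F.Additive] (hP : IsAdapted P F)

include hP

lemma of_isZero {A : C} (hA : IsZero A) : P A :=
  have := hA.injective
  hP.of_injective A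

lemma of_iso {A B : C} (e : A ≅ B) (hA : P A) : P B := by
  let S : ShortComplex C := ShortComplex.mk (0 : (0 : C) ⟶ A) e.hom zero_comp
  have hS : S.ShortExact :=
    { exact := (S.exact_iff_mono rfl).2 (inferInstanceAs (Mono e.hom))
      mono_f := inferInstanceAs (Mono (0 : (0 : C) ⟶ A))
      epi_g := inferInstanceAs (Epi e.hom) }
  exact hP.of_shortExact hS (hP.of_isZero (isZero_zero C)) hA

lemma cycles {K : CochainComplex C ℤ} (hK : K.Acyclic) (hKP : ∀ n, P (K.X n)) (n₀ : ℤ)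
    [K.IsStrictlyGE n₀] (n : ℤ) : P (K.cycles n) := by
  have below : ∀ n < n₀, P (K.cycles n) := fun n hn => hP.of_isZero
    (IsZero.of_mono (K.iCycles n) (K.isZero_of_isStrictlyGE n₀ n hn))
  have succ (n : ℤ) : P (K.cycles n) → P (K.cycles (n + 1)) := fun h =>
    hP.of_shortExact (shortExact_cyclesShortComplex hK n) h (hKP n)
  rcases lt_or_ge n n₀ with hn | hn
  · exact below n hn
  · induction n, hn using Int.leInduction with
    | base => simpa using succ (n₀ - 1) (below _ (sub_one_lt n₀))
    | succ n _ ih => exact succ n ih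

lemma map_acyclic {K : CochainComplex C ℤ} (hK : K.Acyclic) (hKP : ∀ n, P (K.X n)) (n₀ : ℤ)
    [K.IsStrictlyGE n₀] : ((F.mapHomologicalComplex _).obj K).Acyclic := fun n => by
  have hS (i : ℤ) : ((cyclesShortComplex K i (i + 1)).map F).ShortExact :=
    hP.map_shortExact (shortExact_cyclesShortComplex hK i) (hP.cycles hK hKP n₀ i)
  obtain ⟨m, rfl⟩ : ∃ m, n = m + 1 := ⟨n - 1, by simp⟩
  rw [HomologicalComplex.exactAt_iff' _ m (m + 1) (m + 1 + 1) (by simp) (by simp)]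
  have h := @exact_epi_comp_comp_mono _ _ _ _ (hS (m + 1)).exact _ _
    (F.map (K.toCycles m (m + 1))) (hS m).epi_g
    (F.map (K.iCycles (m + 1 + 1))) (hS (m + 1 + 1)).mono_f
  change (ShortComplex.mk (F.map (K.d m (m + 1))) (F.map (K.d (m + 1) (m + 1 + 1))) _).Exact
  simp only [← K.toCycles_i, F.map_comp]
  exact h

lemma map_quasiIso {K L : CochainComplex C ℤ} (hK : ∀ n, P (K.X n)) (hL : ∀ n, P (L.X n))
    (n₁ n₂ : ℤ) [K.IsStrictlyGE n₁] [L.IsStrictlyGE n₂] (φ : K ⟶ L) [QuasiIso φ] :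
    QuasiIso ((F.mapHomologicalComplex _).map φ) := by
  have hcone (n : ℤ) : P ((CochainComplex.mappingCone φ).X n) :=
    hP.of_iso (HomologicalComplex.homotopyCofiber.XIsoBiprod φ n (n + 1) rfl).symm
      (hP.biprod (hK _) (hL _))
  have := CochainComplex.isStrictlyGE_mappingCone φ n₁ n₂ (min (n₁ - 1) n₂) (by simp) (by simp)
  rw [quasiIso_iff_acyclic_mappingCone]
  exact fun n => (hP.map_acyclic ((quasiIso_iff_acyclic_mappingCone φ).1 inferInstance) hcone
    (min (n₁ - 1) n₂) n).of_iso (CochainComplex.mappingCone.mapHomologicalComplexIso φ F)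

lemma map_homotopyCategoryPlus_quasiIso {K L : HomotopyCategory.Plus C}
    (hK : ∀ n, P (K.obj.as.X n)) (hL : ∀ n, P (L.obj.as.X n)) (w : K ⟶ L)
    (hw : HomotopyCategory.Plus.quasiIso C w) :
    HomotopyCategory.Plus.quasiIso D (F.mapHomotopyCategoryPlus.map w) := by
  obtain ⟨n₁, _⟩ := (HomotopyCategory.plus_quotient_obj_iff K.obj.as).1 K.property
  obtain ⟨n₂, _⟩ := (HomotopyCategory.plus_quotient_obj_iff L.obj.as).1 L.property
  obtain ⟨φ : K.obj.as ⟶ L.obj.as, hφ⟩ :=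
    (HomotopyCategory.quotient C (.up ℤ)).map_surjective w.hom
  have : QuasiIso φ := by
    rw [← HomologicalComplex.mem_quasiIso_iff, ← HomotopyCategory.quotient_map_mem_quasiIso_iff]
    exact hφ ▸ (HomotopyCategory.Plus.quasiIso_iff C w).1 hw
  rw [HomotopyCategory.Plus.quasiIso_iff]
  change HomotopyCategory.quasiIso D _ ((F.mapHomotopyCategory _).map w.hom)
  rw [← hφ]
  exact (HomotopyCategory.quotient_map_mem_quasiIso_iff _).2 (hP.map_quasiIso hK hL n₁ n₂ φ)

lemma isIso_rightDerivedFunctorPlusUnit_app [EnoughInjectives C] [HasDerivedCategory C]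
    [HasDerivedCategory D] {K : HomotopyCategory.Plus C} (hK : ∀ n, P (K.obj.as.X n)) :
    IsIso (F.rightDerivedFunctorPlusUnit.app K) := by
  let r : (HomotopyCategory.Plus.localizerMorphism C).RightResolution K := Classical.arbitrary _
  let I := (InjectiveObject.ι C).mapHomotopyCategoryPlus.obj r.X₁
  have hw : IsIso (DerivedCategory.Plus.Qh.map r.w) :=
    Localization.inverts DerivedCategory.Plus.Qh (HomotopyCategory.Plus.quasiIso C) _ r.hw
  have hFw : IsIso (DerivedCategory.Plus.Qh.map (F.mapHomotopyCategoryPlus.map r.w)) :=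
    Localization.inverts DerivedCategory.Plus.Qh (HomotopyCategory.Plus.quasiIso D) _
      (hP.map_homotopyCategoryPlus_quasiIso hK (L := I) (fun _ => hP.of_injective _) r.w r.hw)
  have hI : IsIso (F.rightDerivedFunctorPlusUnit.app I) := inferInstance
  have h : F.rightDerivedFunctorPlusUnit.app K ≫
      F.rightDerivedFunctorPlus.map (DerivedCategory.Plus.Qh.map r.w) =
      DerivedCategory.Plus.Qh.map (F.mapHomotopyCategoryPlus.map r.w) ≫
        F.rightDerivedFunctorPlusUnit.app I :=
    (F.rightDerivedFunctorPlusUnit.naturality r.w).symm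
  rw [← isIso_comp_right_iff _ (F.rightDerivedFunctorPlus.map (DerivedCategory.Plus.Qh.map r.w)), h]
  infer_instance

end IsAdapted

end Adapted

section CommShift

open CategoryTheory.Functor

section Preadditive

variable {C D E : Type*} [Category* C] [Category* D] [Category* E]

lemma natTrans_commShift_of_whiskerRight [HasShift C ℤ] [HasShift D ℤ] [HasShift E ℤ]
    {F G : C ⥤ D} [F.CommShift ℤ] [G.CommShift ℤ] (τ : F ⟶ G) (i : D ⥤ E) [i.CommShift ℤ]
    [i.Faithful] [NatTrans.CommShift (whiskerRight τ i) ℤ] : NatTrans.CommShift τ ℤ where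
  shift_comm a := by
    apply NatTrans.ext
    funext K
    apply i.map_injective
    have key := NatTrans.shift_app_comm (whiskerRight τ i) a K
    have h := (i.commShiftIso a).hom.naturality (τ.app K)
    simp only [commShiftIso_comp_hom_app, whiskerRight_app, Category.assoc, comp_obj,
      Functor.comp_map] at key h
    rw [← h, ← Category.assoc, ← Category.assoc, cancel_mono] at key
    simpa using key

variable [Preadditive C]

lemma natTrans_commShift_of_whiskerLeft_quotient [HasShift E ℤ]
    {F G : HomotopyCategory C (.up ℤ) ⥤ E} [F.CommShift ℤ] [G.CommShift ℤ] (τ : F ⟶ G)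
    [NatTrans.CommShift (whiskerLeft (HomotopyCategory.quotient C (.up ℤ)) τ) ℤ] :
    NatTrans.CommShift τ ℤ := by
  refine natTrans_commShift_of_whiskerLeft (HomotopyCategory.quotient C (.up ℤ)) _ fun K => ?_
  obtain ⟨K, rfl⟩ := HomotopyCategory.quotient_obj_surjective K
  exact ⟨K, 𝟙 _, inferInstance⟩

variable [Preadditive D] [Preadditive E]

instance commShift_mapHomologicalComplex {F G : C ⥤ D} [F.Additive] [G.Additive]
    (τ : F ⟶ G) : NatTrans.CommShift (NatTrans.mapHomologicalComplex τ (.up ℤ)) ℤ where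
  shift_comm a := by
    apply NatTrans.ext
    funext K
    apply HomologicalComplex.hom_ext
    intro n
    exact (Category.id_comp _).trans (Category.comp_id _).symm

instance commShift_mapHomologicalComplexCompIso (F : C ⥤ D) (G : D ⥤ E) [F.Additive] [G.Additive] :
    NatTrans.CommShift (mapHomologicalComplexCompIso (Iso.refl (F ⋙ G)) (.up ℤ)).hom ℤ where
  shift_comm a := by
    apply NatTrans.ext
    funext K
    apply HomologicalComplex.hom_ext
    intro n
    rw [NatTrans.comp_app, commShiftIso_comp_hom_app]
    change (G.map (𝟙 _) ≫ 𝟙 _) ≫ 𝟙 _ = 𝟙 _ ≫ 𝟙 _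
    simp

instance commShift_mapHomotopyCategory {F G : C ⥤ D} [F.Additive] [G.Additive]
    (τ : F ⟶ G) : NatTrans.CommShift (NatTrans.mapHomotopyCategory τ (.up ℤ)) ℤ := by
  have e : whiskerLeft (HomotopyCategory.quotient C _) (NatTrans.mapHomotopyCategory τ (.up ℤ)) =
      (F.mapHomotopyCategoryFactors (.up ℤ)).hom ≫
        whiskerRight (NatTrans.mapHomologicalComplex τ (.up ℤ)) (HomotopyCategory.quotient D _) ≫
        (G.mapHomotopyCategoryFactors (.up ℤ)).inv := by
    ext K
    exact ((Category.id_comp _).trans (Category.comp_id _)).symm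
  have : NatTrans.CommShift (whiskerLeft (HomotopyCategory.quotient C _)
      (NatTrans.mapHomotopyCategory τ (.up ℤ))) ℤ := by
    rw [e]
    infer_instance
  exact natTrans_commShift_of_whiskerLeft_quotient _

instance commShift_mapHomotopyCategoryCompIso (F : C ⥤ D) (G : D ⥤ E) [F.Additive] [G.Additive] :
    NatTrans.CommShift (mapHomotopyCategoryCompIso (Iso.refl (F ⋙ G)) (.up ℤ)).hom ℤ := by
  have e : whiskerLeft (HomotopyCategory.quotient C _)
        (mapHomotopyCategoryCompIso (Iso.refl (F ⋙ G)) (.up ℤ)).hom =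
      (Functor.associator _ _ _).inv ≫
      whiskerRight (F.mapHomotopyCategoryFactors (.up ℤ)).hom (G.mapHomotopyCategory _) ≫
      (Functor.associator _ _ _).hom ≫
      whiskerLeft (F.mapHomologicalComplex _) (G.mapHomotopyCategoryFactors (.up ℤ)).hom ≫
      (Functor.associator _ _ _).inv ≫
      whiskerRight (mapHomologicalComplexCompIso (Iso.refl (F ⋙ G)) (.up ℤ)).hom
        (HomotopyCategory.quotient E _) ≫
      ((F ⋙ G).mapHomotopyCategoryFactors (.up ℤ)).inv := by
    ext K
    change _ = 𝟙 _ ≫ (G.mapHomotopyCategory _).map (𝟙 _) ≫ 𝟙 _ ≫ 𝟙 _ ≫ 𝟙 _ ≫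
      (HomotopyCategory.quotient E _).map
        ((mapHomologicalComplexCompIso (Iso.refl (F ⋙ G)) (.up ℤ)).hom.app K) ≫ 𝟙 _
    simp only [Category.id_comp]
    refine ((congrArg (fun a => a ≫ _) ((G.mapHomotopyCategory _).map_id _)).trans ?_).symm
    exact (Category.id_comp _).trans (Category.comp_id _)
  have : NatTrans.CommShift (whiskerLeft (HomotopyCategory.quotient C _)
      (mapHomotopyCategoryCompIso (Iso.refl (F ⋙ G)) (.up ℤ)).hom) ℤ := by
    rw [e]
    infer_instance
  exact natTrans_commShift_of_whiskerLeft_quotient _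

/-- The functor `F.mapHomotopyCategoryPlus` is induced by `F.mapHomotopyCategory`: the two commute
with the inclusion of the bounded below complexes. -/
def mapHomotopyCategoryPlusCompι (F : C ⥤ D) [F.Additive] :
    F.mapHomotopyCategoryPlus ⋙ HomotopyCategory.Plus.ι D ≅
      HomotopyCategory.Plus.ι C ⋙ F.mapHomotopyCategory (.up ℤ) :=
  ObjectProperty.liftCompιIso ..

instance (F : C ⥤ D) [F.Additive] : NatTrans.CommShift (mapHomotopyCategoryPlusCompι F).hom ℤ :=
  inferInstanceAs (NatTrans.CommShift (ObjectProperty.liftCompιIso ..).hom ℤ)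

end Preadditive

variable {C D E : Type*} [Category* C] [Category* D] [Category* E]
  [Abelian C] [Abelian D] [Abelian E]

instance commShift_natTransMapHomotopyCategoryPlus {F G : C ⥤ D} [F.Additive] [G.Additive]
    (τ : F ⟶ G) : NatTrans.CommShift (natTransMapHomotopyCategoryPlus τ) ℤ := by
  have e : whiskerRight (natTransMapHomotopyCategoryPlus τ) (HomotopyCategory.Plus.ι D) =
      (mapHomotopyCategoryPlusCompι F).hom ≫
        whiskerLeft (HomotopyCategory.Plus.ι C) (NatTrans.mapHomotopyCategory τ (.up ℤ)) ≫
        (mapHomotopyCategoryPlusCompι G).inv := by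
    ext K
    exact ((Category.id_comp _).trans (Category.comp_id _)).symm
  have : NatTrans.CommShift (whiskerRight (natTransMapHomotopyCategoryPlus τ)
      (HomotopyCategory.Plus.ι D)) ℤ := by
    rw [e]
    infer_instance
  exact natTrans_commShift_of_whiskerRight _ (HomotopyCategory.Plus.ι D)

instance commShift_mapHomotopyCategoryPlusCompIso (F : C ⥤ D) (G : D ⥤ E)
    [F.Additive] [G.Additive] :
    NatTrans.CommShift (mapHomotopyCategoryPlusCompIso (Iso.refl (F ⋙ G))).hom ℤ := by
  have e : whiskerRight (mapHomotopyCategoryPlusCompIso (Iso.refl (F ⋙ G))).hom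
        (HomotopyCategory.Plus.ι E) =
      (Functor.associator _ _ _).hom ≫
      whiskerLeft F.mapHomotopyCategoryPlus (mapHomotopyCategoryPlusCompι G).hom ≫
      (Functor.associator _ _ _).inv ≫
      whiskerRight (mapHomotopyCategoryPlusCompι F).hom (G.mapHomotopyCategory (.up ℤ)) ≫
      (Functor.associator _ _ _).hom ≫
      whiskerLeft (HomotopyCategory.Plus.ι C)
        (mapHomotopyCategoryCompIso (Iso.refl (F ⋙ G)) (.up ℤ)).hom ≫
      (mapHomotopyCategoryPlusCompι (F ⋙ G)).inv := by
    ext K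
    change _ = 𝟙 _ ≫ 𝟙 _ ≫ 𝟙 _ ≫ (G.mapHomotopyCategory _).map (𝟙 _) ≫ 𝟙 _ ≫
      (mapHomotopyCategoryCompIso (Iso.refl (F ⋙ G)) (.up ℤ)).hom.app K.obj ≫ 𝟙 _
    simp only [Category.id_comp, Category.comp_id]
    refine ((congrArg (fun a => a ≫ _) ((G.mapHomotopyCategory _).map_id _)).trans ?_).symm
    exact Category.id_comp _
  have : NatTrans.CommShift (whiskerRight (mapHomotopyCategoryPlusCompIso (Iso.refl (F ⋙ G))).hom
      (HomotopyCategory.Plus.ι E)) ℤ := by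
    rw [e]
    infer_instance
  exact natTrans_commShift_of_whiskerRight _ (HomotopyCategory.Plus.ι E)

lemma isIso_natTransMapHomotopyCategoryPlus_app {F G : C ⥤ D} [F.Additive] [G.Additive]
    (τ : F ⟶ G) [IsIso τ] (K : HomotopyCategory.Plus C) :
    IsIso ((natTransMapHomotopyCategoryPlus τ).app K) := by
  have (n : ℤ) : IsIso (((NatTrans.mapHomologicalComplex τ (.up ℤ)).app K.obj.as).f n) :=
    inferInstanceAs (IsIso (τ.app (K.obj.as.X n)))
  have : IsIso ((NatTrans.mapHomologicalComplex τ (.up ℤ)).app K.obj.as) :=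
    HomologicalComplex.Hom.isIso_of_components _
  have : IsIso ((HomotopyCategory.Plus.ι D).map ((natTransMapHomotopyCategoryPlus τ).app K)) :=
    inferInstanceAs (IsIso ((HomotopyCategory.quotient D _).map
      ((NatTrans.mapHomologicalComplex τ (.up ℤ)).app K.obj.as)))
  exact isIso_of_reflects_iso _ (HomotopyCategory.Plus.ι D)

end CommShift

section RightDerived

open CategoryTheory.Functor

variable {C D E : Type*} [Category* C] [Category* D] [Category* E]
  [Abelian C] [Abelian D] [Abelian E]
  [HasDerivedCategory C] [HasDerivedCategory D] [HasDerivedCategory E] [EnoughInjectives C]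

lemma natTrans_commShift_of_rightDerivedFunctorPlusUnit_comp {F : C ⥤ D} [F.Additive]
    {G : DerivedCategory.Plus C ⥤ DerivedCategory.Plus D} [G.CommShift ℤ]
    (τ : F.rightDerivedFunctorPlus ⟶ G)
    {β : F.mapHomotopyCategoryPlus ⋙ DerivedCategory.Plus.Qh ⟶ DerivedCategory.Plus.Qh ⋙ G}
    [NatTrans.CommShift β ℤ]
    (h : F.rightDerivedFunctorPlusUnit ≫ whiskerLeft DerivedCategory.Plus.Qh τ = β) :
    NatTrans.CommShift τ ℤ := by
  have e : whiskerLeft (injectivesToDerivedPlus C) τ =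
      (rightDerivedFunctorPlusInjectivesIso F).hom ≫
        whiskerLeft (InjectiveObject.ι C).mapHomotopyCategoryPlus β ≫
        (Functor.associator _ _ _).inv := by
    rw [← Iso.inv_comp_eq, ← h]
    ext K
    exact (Category.comp_id _).symm
  have : NatTrans.CommShift (whiskerLeft (injectivesToDerivedPlus C) τ) ℤ := by
    rw [e]
    infer_instance
  refine natTrans_commShift_of_whiskerLeft (injectivesToDerivedPlus C) _ fun K => ?_
  exact ⟨_, ((injectivesToDerivedPlus C).objObjPreimageIso K).inv, inferInstance⟩

lemma natTrans_isIso_of_isIso_app_injectives {H : Type*} [Category* H]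
    {G₁ G₂ : DerivedCategory.Plus C ⥤ H} (τ : G₁ ⟶ G₂)
    (h : ∀ K : HomotopyCategory.Plus (InjectiveObject C),
      IsIso (τ.app ((injectivesToDerivedPlus C).obj K))) : IsIso τ := by
  rw [NatTrans.isIso_iff_isIso_app]
  intro M
  rw [← NatTrans.isIso_app_iff_of_iso τ ((injectivesToDerivedPlus C).objObjPreimageIso M)]
  exact h _

section NatTrans

variable {F G : C ⥤ D} [F.Additive] [G.Additive] (τ : F ⟶ G)

lemma rightDerivedFunctorPlusUnit_comp_rightDerivedPlusNatTrans :
    F.rightDerivedFunctorPlusUnit ≫ whiskerLeft DerivedCategory.Plus.Qh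
      (rightDerivedPlusNatTrans τ) =
    whiskerRight (natTransMapHomotopyCategoryPlus τ) DerivedCategory.Plus.Qh ≫
      G.rightDerivedFunctorPlusUnit :=
  rightDerivedNatTrans_fac _ _ _ _ _ _

lemma isIso_rightDerivedPlusNatTrans [IsIso τ] : IsIso (rightDerivedPlusNatTrans τ) := by
  refine natTrans_isIso_of_isIso_app_injectives _ fun K => ?_
  let I := (InjectiveObject.ι C).mapHomotopyCategoryPlus.obj K
  have e : F.rightDerivedFunctorPlusUnit.app I ≫
      (rightDerivedPlusNatTrans τ).app ((injectivesToDerivedPlus C).obj K) =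
      DerivedCategory.Plus.Qh.map ((natTransMapHomotopyCategoryPlus τ).app I) ≫
        G.rightDerivedFunctorPlusUnit.app I :=
    NatTrans.congr_app (rightDerivedFunctorPlusUnit_comp_rightDerivedPlusNatTrans τ) I
  have := isIso_natTransMapHomotopyCategoryPlus_app τ I
  have : IsIso (F.rightDerivedFunctorPlusUnit.app I) := inferInstance
  have : IsIso (G.rightDerivedFunctorPlusUnit.app I) := inferInstance
  refine (isIso_comp_left_iff (F.rightDerivedFunctorPlusUnit.app I) _).1 ?_
  rw [e]
  infer_instance

lemma isTriangulatedIso_rightDerivedPlusNatTrans [IsIso τ] :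
    IsTriangulatedIso (rightDerivedPlusNatTrans τ) where
  source_isTriangulated := inferInstance
  target_isTriangulated := inferInstance
  commShift := natTrans_commShift_of_rightDerivedFunctorPlusUnit_comp _
    (rightDerivedFunctorPlusUnit_comp_rightDerivedPlusNatTrans τ)
  isIso := isIso_rightDerivedPlusNatTrans τ

end NatTrans

section Comp

variable [EnoughInjectives D] (F : C ⥤ D) (G : D ⥤ E) [F.Additive] [G.Additive]

lemma rightDerivedFunctorPlusUnit_comp_rightDerivedPlusComp :
    (F ⋙ G).rightDerivedFunctorPlusUnit ≫ whiskerLeft DerivedCategory.Plus.Qh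
      (rightDerivedPlusComp F G) =
    whiskerRight (mapHomotopyCategoryPlusCompIso (Iso.refl (F ⋙ G))).inv DerivedCategory.Plus.Qh ≫
      (Functor.associator _ _ _).hom ≫
      whiskerLeft F.mapHomotopyCategoryPlus G.rightDerivedFunctorPlusUnit ≫
      (Functor.associator _ _ _).inv ≫
      whiskerRight F.rightDerivedFunctorPlusUnit G.rightDerivedFunctorPlus ≫
      (Functor.associator _ _ _).hom := by
  refine (rightDerived_fac _ _ _ _ _).trans ?_
  ext K
  simp

variable {F G}

lemma isIso_rightDerivedPlusComp
    (h : ∀ K : HomotopyCategory.Plus (InjectiveObject C), IsIso (G.rightDerivedFunctorPlusUnit.app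
      (F.mapHomotopyCategoryPlus.obj ((InjectiveObject.ι C).mapHomotopyCategoryPlus.obj K)))) :
    IsIso (rightDerivedPlusComp F G) := by
  refine natTrans_isIso_of_isIso_app_injectives _ fun K => ?_
  let I := (InjectiveObject.ι C).mapHomotopyCategoryPlus.obj K
  have e : (F ⋙ G).rightDerivedFunctorPlusUnit.app I ≫
      (rightDerivedPlusComp F G).app ((injectivesToDerivedPlus C).obj K) =
      DerivedCategory.Plus.Qh.map ((mapHomotopyCategoryPlusCompIso (Iso.refl (F ⋙ G))).inv.app I) ≫
      G.rightDerivedFunctorPlusUnit.app (F.mapHomotopyCategoryPlus.obj I) ≫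
      G.rightDerivedFunctorPlus.map (F.rightDerivedFunctorPlusUnit.app I) :=
    rightDerived_fac_app _ _ _ _ _ I
  have : IsIso ((F ⋙ G).rightDerivedFunctorPlusUnit.app I) := inferInstance
  have : IsIso (F.rightDerivedFunctorPlusUnit.app I) := inferInstance
  have : IsIso (G.rightDerivedFunctorPlusUnit.app (F.mapHomotopyCategoryPlus.obj I)) := h K
  refine (isIso_comp_left_iff ((F ⋙ G).rightDerivedFunctorPlusUnit.app I) _).1 ?_
  rw [e]
  infer_instance

lemma IsAdapted.isTriangulatedIso_rightDerivedPlusComp {P : ObjectProperty D} (hP : IsAdapted P G)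
    (hF : ∀ (I : C) [Injective I], P (F.obj I)) :
    IsTriangulatedIso (rightDerivedPlusComp F G) where
  source_isTriangulated := inferInstance
  target_isTriangulated := inferInstance
  commShift := natTrans_commShift_of_rightDerivedFunctorPlusUnit_comp _
    (rightDerivedFunctorPlusUnit_comp_rightDerivedPlusComp F G)
  isIso := isIso_rightDerivedPlusComp fun K => hP.isIso_rightDerivedFunctorPlusUnit_app fun n =>
    hF (((InjectiveObject.ι C).mapHomotopyCategoryPlus.obj K).obj.as.X n)

end Comp

end RightDerived

namespace IsTriangulatedIso

variable {C D : Type*} [Category* C] [Category* D]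
  [HasZeroObject C] [HasShift C ℤ] [Preadditive C] [∀ n : ℤ, (shiftFunctor C n).Additive]
  [Pretriangulated C]
  [HasZeroObject D] [HasShift D ℤ] [Preadditive D] [∀ n : ℤ, (shiftFunctor D n).Additive]
  [Pretriangulated D]
  {F G H : C ⥤ D} [F.CommShift ℤ] [G.CommShift ℤ] [H.CommShift ℤ]

lemma comp {τ : F ⟶ G} {σ : G ⟶ H} (hτ : IsTriangulatedIso τ) (hσ : IsTriangulatedIso σ) :
    IsTriangulatedIso (τ ≫ σ) :=
  have := hτ.commShift
  have := hτ.isIso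
  have := hσ.commShift
  have := hσ.isIso
  ⟨hτ.source_isTriangulated, hσ.target_isTriangulated, inferInstance, inferInstance⟩

lemma exists_comp_eq {τ : F ⟶ G} {σ : F ⟶ H} (hτ : IsTriangulatedIso τ)
    (hσ : IsTriangulatedIso σ) : ∃ θ : G ⟶ H, IsTriangulatedIso θ ∧ τ ≫ θ = σ :=
  have := hτ.commShift
  have := hτ.isIso
  have : NatTrans.CommShift (inv τ) ℤ := NatTrans.CommShift.of_isIso τ ℤ
  ⟨inv τ ≫ σ,
    comp ⟨hτ.target_isTriangulated, hτ.source_isTriangulated, inferInstance, inferInstance⟩ hσ,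
    IsIso.hom_inv_id_assoc _ _⟩

end IsTriangulatedIso

namespace Sh

variable {W X Y Z : TopCat.{u}} {f : Y ⟶ X} {g : W ⟶ Z} {p : Z ⟶ X} {q : W ⟶ Y}

lemma isAdapted_inverseImage (p : Z ⟶ X) :
    IsAdapted (⊤ : ObjectProperty (Sh X)) (inverseImage p) where
  of_injective _ _ := trivial
  biprod _ _ := trivial
  of_shortExact _ _ _ := trivial
  map_shortExact hS _ := shortExact_map_inverseImage p hS

lemma isAdapted_properDirectImage (hg : IsSeparatedMap g) (hg' : IsLocallyProper g) :
    IsAdapted (IsSoftOnFibers g) (properDirectImage g) where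
  of_injective I _ := isSoftOnFibers_of_isFlasque hg hg' I
  biprod := isSoftOnFibers_biprod
  of_shortExact hS := isSoftOnFibers_of_shortExact hg hg' hS
  map_shortExact hS := shortExact_map_properDirectImage hS hg hg'

end Sh

theorem theoremt {W X Y Z : TopCat.{u}}
    [HasDerivedCategory.{w₁} (Sh W)] [HasDerivedCategory.{w₂} (Sh X)]
    [HasDerivedCategory.{w₃} (Sh Y)] [HasDerivedCategory.{w₄} (Sh Z)]
    (f : Y ⟶ X) (g : W ⟶ Z) (p : Z ⟶ X) (q : W ⟶ Y) (sq : IsPullback q g f p)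
    (hf : IsSeparatedMap f) (hf' : IsLocallyProper f)
    (hg : IsSeparatedMap g) (hg' : IsLocallyProper g) :
    IsTriangulatedIso
      (Functor.rightDerivedPlusComp (Sh.properDirectImage f) (Sh.inverseImage p)) ∧
    IsTriangulatedIso
      (Functor.rightDerivedPlusComp (Sh.inverseImage q) (Sh.properDirectImage g)) ∧
    ∃ θ : Sh.derivedProperDirectImage f ⋙ Sh.derivedInverseImage p ⟶
        Sh.derivedInverseImage q ⋙ Sh.derivedProperDirectImage g,
      IsTriangulatedIso θ ∧
      Functor.rightDerivedPlusComp (Sh.properDirectImage f) (Sh.inverseImage p) ≫ θ =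
        Functor.rightDerivedPlusNatTrans (Sh.baseChange sq) ≫
          Functor.rightDerivedPlusComp (Sh.inverseImage q) (Sh.properDirectImage g) := by
  have hfp : IsTriangulatedIso
      (Functor.rightDerivedPlusComp (Sh.properDirectImage f) (Sh.inverseImage p)) :=
    (Sh.isAdapted_inverseImage p).isTriangulatedIso_rightDerivedPlusComp fun _ _ => trivial
  have hqg : IsTriangulatedIso
      (Functor.rightDerivedPlusComp (Sh.inverseImage q) (Sh.properDirectImage g)) :=
    (Sh.isAdapted_properDirectImage hg hg').isTriangulatedIso_rightDerivedPlusComp fun I _ =>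
      Sh.isSoftOnFibers_inverseImage_of_isFlasque sq hf hg' I
  have := Sh.isIso_baseChange sq hf hf'
  have hβ := isTriangulatedIso_rightDerivedPlusNatTrans (Sh.baseChange sq)
  exact ⟨hfp, hqg, hfp.exists_comp_eq (hβ.comp hqg)⟩
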